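/- For a finite set $P$ of at least three points in the Euclidean plane $\mathbb{R}^2$, a spanning cycle on $P$ is an (undirected) Hamiltonian cycle in the complete graph on $P$, drawn with straight-line edges; its length is the sum of the Euclidean lengths of its edges. Two edges cross if their relative interiors intersect, and a cycle is noncrossing if no two distinct edges of it cross. Theorem. For every integer $n \ge 3$ there exists a set $P$ of $n$ points in the plane for which the longest spanning cycle is unique and noncrossing: exactly one spanning cycle on $P$ attains the maximum length among all spanning cycles on $P$, and this cycle is noncrossing. Consequently, the conjecture of Álvarez-Rebollar et al. that the longest spanning cycle on every sufficiently large finite set of points in the plane has a pair of crossing edges is false: there is no integer $N$ such that every finite set $P$ of at least $N$ points in the plane has a longest spanning cycle with two crossing edges. -/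

import Mathlib

/-- The Euclidean plane. -/
abbrev Plane : Type := EuclideanSpace ℝ (Fin 2)

/-- `C` is a spanning (Hamiltonian) cycle in the complete geometric graph on the finite point
set `P`: an undirected graph with vertex set exactly `P` that is a cycle (through at least three
vertices). -/
def IsSpanningCycle {P : Finset Plane} (C : SimpleGraph P) : Prop :=
  3 ≤ P.card ∧ Nonempty (SimpleGraph.cycleGraph P.card ≃g C)

/-- The Euclidean length of the straight-line edge with the given pair of endpoints. -/
noncomputable def edgeLength {P : Finset Plane} (e : Sym2 P) : ℝ :=
  Sym2.lift ⟨fun a b : P => dist (a : Plane) (b : Plane), fun a b => dist_comm (a : Plane) b⟩ e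

open Classical in
/-- The length of a geometric graph: the sum of the lengths of its (undirected) edges. -/
noncomputable def graphLength {P : Finset Plane} (G : SimpleGraph P) : ℝ :=
  ∑ e ∈ G.edgeFinset, edgeLength e

/-- Two segments cross if their relative interiors intersect; a geometric graph is noncrossing
if no two distinct edges of it cross. -/
def IsNoncrossing {P : Finset Plane} (G : SimpleGraph P) : Prop :=
  ∀ a b c d : P, G.Adj a b → G.Adj c d → s(a, b) ≠ s(c, d) →
    Disjoint (openSegment ℝ (a : Plane) (b : Plane)) (openSegment ℝ (c : Plane) (d : Plane))

/-- `C` is a longest spanning cycle on `P`. -/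
def IsLongestSpanningCycle {P : Finset Plane} (C : SimpleGraph P) : Prop :=
  IsSpanningCycle C ∧ ∀ D : SimpleGraph P, IsSpanningCycle D → graphLength D ≤ graphLength C

/-! Points are numbered `o, …, 2m+2`, with `o = 0` or `1` according to the parity of `n`, and `i /
2` is the level of point `i`. Successive levels lie alternately right and left of the vertical axis.
Distances `mag i` from the axis grow like `8 ^ i`, heights decay like `δ ^ (i / 2)`, and every
height is multiplied by `√s`. First `δ` is taken small, then `s` small in terms of `δ`.

For `s = 0` a cycle has length at most `∑ 2 * mag i`, with equality exactly for the alternating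
cycles, whose edges all reach across the axis or end at the point `0` on it. For small `s` only
these compete, and they are ranked by the derivative in `s`, half the sum of `(height difference)² /
(horizontal distance)` (`eventually_cost_segmentLength_lt`).

As `δ → 0` that sum is compared lexicographically by level, each edge being charged to its smaller
endpoint (`eventually_cost_lt_of_level`). This makes the optimization greedy. Once a cycle agrees
with the zigzag below level `t ≥ 1`, each of the two points of level `t` has one free edge, going to
a later point; unless `t = m`, the two targets differ, since otherwise the cycle would close too
early. The best choice joins the outer point `2t+1` to `2t+2` and the inner point `2t` to `2t+3`
(`levelCost_add_lt`), which is what the zigzag does (`agree_or_levelCost_lt`); level 0 is handled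
numerically. Hence the zigzag is the unique optimum (`exists_parameters`).

The zigzag is noncrossing because any two of its edges are separated by a horizontal line or by the
line through `2t+1` and `2t+2` for some `t` (`separated_of_zigzagRel`). -/

open Filter Topology

/-! ### Cycles on sets of natural numbers; the zigzag cycle -/

/-- `G` is a Hamiltonian cycle on the finite set `S` of natural numbers: it is supported on `S`,
2-regular there, and connected. -/
structure IsCycleOn (S : Finset ℕ) (G : SimpleGraph ℕ) : Prop where
  mem_of_adj : ∀ {i j : ℕ}, G.Adj i j → i ∈ S
  neighborSet_eq_pair : ∀ i ∈ S, ∃ a b : ℕ, a ≠ b ∧ ∀ j, G.Adj i j ↔ j = a ∨ j = b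
  eq_of_closed : ∀ T ⊆ S, T.Nonempty → (∀ i ∈ T, ∀ j, G.Adj i j → j ∈ T) → T = S

theorem IsCycleOn.exists_other {S : Finset ℕ} {G : SimpleGraph ℕ} (hG : IsCycleOn S G) {i d : ℕ}
    (h : G.Adj i d) : ∃ k, k ≠ d ∧ ∀ j, G.Adj i j ↔ j = d ∨ j = k := by
  obtain ⟨a, b, hab, hN⟩ := hG.neighborSet_eq_pair i (hG.mem_of_adj h)
  rcases (hN d).1 h with rfl | rfl
  · exact ⟨b, hab.symm, hN⟩
  · exact ⟨a, hab, fun j => (hN j).trans or_comm⟩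

/-- The pairs `i < j` of the zigzag cycle on `{o, ..., 2m+2}`. -/
def ZigzagRel (o m i j : ℕ) : Prop :=
  o ≤ i ∧ j ≤ 2 * m + 2 ∧ ((i % 2 = 1 ∧ j = i + 1) ∨ (i % 2 = 0 ∧ j = i + 3) ∨
    (i = 2 * m ∧ j = 2 * m + 2) ∨ (i = 0 ∧ j = 1) ∨ (o = 1 ∧ i = 1 ∧ j = 3))

/-- The zigzag cycle on `{o, ..., 2m+2}`, for `o ≤ 1`. -/
def zigzag (o m : ℕ) : SimpleGraph ℕ where
  Adj i j := ZigzagRel o m i j ∨ ZigzagRel o m j i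
  symm := ⟨fun _ _ h => h.symm⟩
  loopless := ⟨fun i h => by unfold ZigzagRel at h; omega⟩

theorem zigzag_adj {o m i j : ℕ} :
    (zigzag o m).Adj i j ↔ ZigzagRel o m i j ∨ ZigzagRel o m j i := Iff.rfl

/-- The `k`-th vertex of the zigzag cycle. -/
def zigzagVertex (m k : ℕ) : ℕ :=
  if k ≤ m then 2 * k + k % 2
  else if k = m + 1 then 2 * m + 2
  else 2 * (2 * m + 2 - k) + (2 * m + 2 - k + 1) % 2

/-- The cycle climbs `0, 3, 4, 7, 8, …` to the apex `2m+2` and returns along `…, 6, 5, 2, 1`.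
Splitting by branch and parity makes every value linear, so that adjacency questions become
accessible to `omega`. -/
theorem zigzagVertex_cases {m k : ℕ} (hk : k < 2 * m + 3) :
    (∃ q, k = 2 * q ∧ k ≤ m ∧ zigzagVertex m k = 4 * q) ∨
    (∃ q, k = 2 * q + 1 ∧ k ≤ m ∧ zigzagVertex m k = 4 * q + 3) ∨
    (k = m + 1 ∧ zigzagVertex m k = 2 * m + 2) ∨
    (∃ q, k + 2 * q = 2 * m + 2 ∧ 2 * q ≤ m ∧ zigzagVertex m k = 4 * q + 1) ∨
    (∃ q, k + (2 * q + 1) = 2 * m + 2 ∧ 2 * q + 1 ≤ m ∧ zigzagVertex m k = 4 * q + 2) := by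
  unfold zigzagVertex
  split_ifs with h1 h2
  · rcases Nat.even_or_odd' k with ⟨q, h | h⟩
    · exact Or.inl ⟨q, h, h1, by omega⟩
    · exact Or.inr (Or.inl ⟨q, h, h1, by omega⟩)
  · exact Or.inr (Or.inr (Or.inl ⟨h2, rfl⟩))
  · obtain ⟨t, ht⟩ : ∃ t, 2 * m + 2 = k + t := ⟨2 * m + 2 - k, by omega⟩
    rw [show 2 * m + 2 - k = t by omega]
    rcases Nat.even_or_odd' t with ⟨q, h | h⟩
    · exact Or.inr (Or.inr (Or.inr (Or.inl ⟨q, by omega, by omega, by omega⟩)))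
    · exact Or.inr (Or.inr (Or.inr (Or.inr ⟨q, by omega, by omega, by omega⟩)))

theorem zigzagVertex_mem {o m k : ℕ} (ho : o ≤ 1) (h1 : o ≤ k) (h2 : k < 2 * m + 3) :
    o ≤ zigzagVertex m k ∧ zigzagVertex m k < 2 * m + 3 := by
  rcases zigzagVertex_cases h2 with
    ⟨q, h, h', hv⟩ | ⟨q, h, h', hv⟩ | ⟨h', hv⟩ | ⟨q, h, h', hv⟩ | ⟨q, h, h', hv⟩ <;> omega

theorem zigzagVertex_injective {m k l : ℕ} (hk : k < 2 * m + 3) (hl : l < 2 * m + 3)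
    (h : zigzagVertex m k = zigzagVertex m l) : k = l := by
  rcases zigzagVertex_cases hk with
    ⟨q, h1, h', hv⟩ | ⟨q, h1, h', hv⟩ | ⟨h', hv⟩ | ⟨q, h1, h', hv⟩ | ⟨q, h1, h', hv⟩ <;>
  rcases zigzagVertex_cases hl with
    ⟨p, g1, g', gv⟩ | ⟨p, g1, g', gv⟩ | ⟨g', gv⟩ | ⟨p, g1, g', gv⟩ | ⟨p, g1, g', gv⟩ <;>
  omega

theorem ZigzagRel.of_zigzagVertex {o m k l : ℕ} (hk : o ≤ k) (hk' : k < 2 * m + 3)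
    (hl : o ≤ l) (hl' : l < 2 * m + 3)
    (h : ZigzagRel o m (zigzagVertex m k) (zigzagVertex m l)) :
    l = k + 1 ∨ k = l + 1 ∨ (k = o ∧ l = 2 * m + 2) ∨ (l = o ∧ k = 2 * m + 2) := by
  obtain ⟨h1, h2, h⟩ := h
  rcases zigzagVertex_cases hk' with
    ⟨q, h3, h', hv⟩ | ⟨q, h3, h', hv⟩ | ⟨h', hv⟩ | ⟨q, h3, h', hv⟩ | ⟨q, h3, h', hv⟩ <;>
  rcases zigzagVertex_cases hl' with
    ⟨p, g3, g', gv⟩ | ⟨p, g3, g', gv⟩ | ⟨g', gv⟩ | ⟨p, g3, g', gv⟩ | ⟨p, g3, g', gv⟩ <;>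
  rw [hv] at h h1 <;> rw [gv] at h h2 <;> clear hv gv hk' hl' <;>
  rcases h with h | h | h | h | h <;> omega

theorem zigzag_adj_zigzagVertex_succ {o m k : ℕ} (ho : o ≤ 1) (hk : o ≤ k)
    (hk' : k + 1 < 2 * m + 3) :
    (zigzag o m).Adj (zigzagVertex m k) (zigzagVertex m (k + 1)) := by
  have h1 := zigzagVertex_mem ho hk (by omega : k < 2 * m + 3)
  have h2 := zigzagVertex_mem ho (by omega : o ≤ k + 1) hk'
  suffices h : ∀ i j, zigzagVertex m k = i → zigzagVertex m (k + 1) = j →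
      (i % 2 = 1 ∧ j = i + 1) ∨ (i % 2 = 0 ∧ j = i + 3) ∨ (i = 2 * m ∧ j = 2 * m + 2) ∨
      (j % 2 = 1 ∧ i = j + 1) ∨ (j % 2 = 0 ∧ i = j + 3) ∨ (j = 2 * m ∧ i = 2 * m + 2) by
    rcases h _ _ rfl rfl with h | h | h | h | h | h
    · exact Or.inl ⟨h1.1, by omega, Or.inl h⟩
    · exact Or.inl ⟨h1.1, by omega, Or.inr (Or.inl h)⟩
    · exact Or.inl ⟨h1.1, by omega, Or.inr (Or.inr (Or.inl h))⟩
    · exact Or.inr ⟨h2.1, by omega, Or.inl h⟩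
    · exact Or.inr ⟨h2.1, by omega, Or.inr (Or.inl h)⟩
    · exact Or.inr ⟨h2.1, by omega, Or.inr (Or.inr (Or.inl h))⟩
  intro i j hi hj
  clear h1 h2
  rcases zigzagVertex_cases (by omega : k < 2 * m + 3) with
    ⟨q, h3, h', hv⟩ | ⟨q, h3, h', hv⟩ | ⟨h', hv⟩ | ⟨q, h3, h', hv⟩ | ⟨q, h3, h', hv⟩ <;>
  rcases zigzagVertex_cases hk' with
    ⟨p, g3, g', gv⟩ | ⟨p, g3, g', gv⟩ | ⟨g', gv⟩ | ⟨p, g3, g', gv⟩ | ⟨p, g3, g', gv⟩ <;>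
  rw [hv] at hi <;> rw [gv] at hj <;> clear hv gv hk' <;> omega

theorem zigzag_adj_zigzagVertex_last {o m : ℕ} (ho : o ≤ 1) (hm : o ≤ m) :
    (zigzag o m).Adj (zigzagVertex m o) (zigzagVertex m (2 * m + 2)) := by
  have h : zigzagVertex m (2 * m + 2) = 1 := by
    unfold zigzagVertex; split_ifs <;> omega
  rw [h, zigzag_adj]
  -- For `o = 1` the vertex `0` is skipped: the tour starts at position 1, which is the point `3`,
  -- and closes with the extra edge from `1` to `3`.
  interval_cases o
  · have h : zigzagVertex m 0 = 0 := by simp [zigzagVertex]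
    rw [h]
    exact Or.inl ⟨le_rfl, by omega, by omega⟩
  · have h : zigzagVertex m 1 = 3 := by simp [zigzagVertex, hm]
    rw [h]
    exact Or.inr ⟨le_rfl, by omega, by omega⟩

theorem zigzag_adj_zigzagVertex {o m k l : ℕ} (ho : o ≤ 1) (hm : o ≤ m) (hk : o ≤ k)
    (hk' : k < 2 * m + 3) (hl : o ≤ l) (hl' : l < 2 * m + 3) :
    (zigzag o m).Adj (zigzagVertex m k) (zigzagVertex m l) ↔
      l = k + 1 ∨ k = l + 1 ∨ (k = o ∧ l = 2 * m + 2) ∨ (l = o ∧ k = 2 * m + 2) := by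
  constructor
  · rintro (h | h)
    · exact h.of_zigzagVertex hk hk' hl hl'
    · have := h.of_zigzagVertex hl hl' hk hk'
      omega
  · rintro (rfl | rfl | ⟨rfl, rfl⟩ | ⟨rfl, rfl⟩)
    · exact zigzag_adj_zigzagVertex_succ ho hk hl'
    · exact (zigzag_adj_zigzagVertex_succ ho hl hk').symm
    · exact zigzag_adj_zigzagVertex_last ho hm
    · exact (zigzag_adj_zigzagVertex_last ho hm).symm

/-! ### Transport between abstract cycles and cycles on `ℕ` -/

theorem cycleGraph_adj_iff {n : ℕ} (hn : 3 ≤ n) (a b : Fin n) :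
    (SimpleGraph.cycleGraph n).Adj a b ↔ b.val = a.val + 1 ∨ a.val = b.val + 1 ∨
      (a.val = 0 ∧ b.val + 1 = n) ∨ (b.val = 0 ∧ a.val + 1 = n) := by
  obtain ⟨n, rfl⟩ : ∃ k, n = k + 2 := ⟨n - 2, by omega⟩
  rw [SimpleGraph.cycleGraph_adj, sub_eq_iff_eq_add, sub_eq_iff_eq_add]
  have ha := a.isLt
  have hb := b.isLt
  have key : ∀ c : Fin (n + 2), (1 + c).val = if c.val = n + 1 then 0 else c.val + 1 := by
    intro c
    rw [show (1 + c : Fin (n + 2)) = c + 1 from add_comm _ _, Fin.val_add_one]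
    simp [Fin.ext_iff]
  rw [Fin.ext_iff, Fin.ext_iff, key, key]
  split_ifs <;> omega

/-- A graph on a type that is numbered by `S`, transported to `ℕ`. -/
def transportGraph {S : Finset ℕ} {W : Type*} (e : S ≃ W) (D : SimpleGraph W) : SimpleGraph ℕ where
  Adj i j := ∃ (hi : i ∈ S) (hj : j ∈ S), D.Adj (e ⟨i, hi⟩) (e ⟨j, hj⟩)
  symm := ⟨fun _ _ ⟨hi, hj, h⟩ => ⟨hj, hi, h.symm⟩⟩
  loopless := ⟨fun _ ⟨_, _, h⟩ => D.loopless.irrefl _ h⟩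

theorem isCycleOn_transportGraph {S : Finset ℕ} {W : Type*} (e : S ≃ W) (D : SimpleGraph W)
    {n : ℕ} (hn : 3 ≤ n) (f : SimpleGraph.cycleGraph n ≃g D) :
    IsCycleOn S (transportGraph e D) := by
  refine ⟨fun ⟨h, _⟩ => h, ?_, ?_⟩
  · intro i hi
    set p := f.symm (e ⟨i, hi⟩) with hp
    have hdeg : ∃ a b : Fin n, a ≠ b ∧ ∀ c, (SimpleGraph.cycleGraph n).Adj p c ↔ c = a ∨ c = b := by
      have hlt := p.isLt
      refine ⟨⟨if p.val + 1 = n then 0 else p.val + 1, by split_ifs <;> omega⟩,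
        ⟨if p.val = 0 then n - 1 else p.val - 1, by split_ifs <;> omega⟩, ?_, ?_⟩
      · simp only [ne_eq, Fin.mk.injEq]; split_ifs <;> omega
      · intro c
        have := c.isLt
        rw [cycleGraph_adj_iff hn, Fin.ext_iff, Fin.ext_iff]
        dsimp only
        split_ifs <;> omega
    obtain ⟨a, b, hab, h⟩ := hdeg
    refine ⟨(e.symm (f a)).val, (e.symm (f b)).val, ?_, ?_⟩
    · intro h'
      exact hab (f.injective (e.symm.injective (Subtype.ext h')))
    · intro j
      constructor
      · rintro ⟨_, hj, hadj⟩
        have h1 : (SimpleGraph.cycleGraph n).Adj p (f.symm (e ⟨j, hj⟩)) :=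
          f.symm.map_rel_iff.2 hadj
        rcases (h _).1 h1 with h2 | h2
        · left; rw [← h2]; simp
        · right; rw [← h2]; simp
      · have aux : ∀ c, (c = a ∨ c = b) → j = (e.symm (f c)).val →
            (transportGraph e D).Adj i j := by
          intro c hc hj
          subst hj
          refine ⟨hi, (e.symm (f c)).2, ?_⟩
          have := f.map_rel_iff.2 ((h c).2 hc)
          simpa [hp] using this
        rintro (hj | hj)
        · exact aux a (Or.inl rfl) hj
        · exact aux b (Or.inr rfl) hj
  · rintro T hT ⟨i, hi⟩ hcl
    have hconn : D.Preconnected := by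
      obtain ⟨k, rfl⟩ : ∃ k, n = k + 1 := ⟨n - 1, by omega⟩
      exact (f.connected_iff.1 SimpleGraph.cycleGraph_connected).preconnected
    refine Finset.Subset.antisymm hT fun j hj => ?_
    -- A set closed under adjacency is closed along walks, so connectedness forces it to be
    -- everything.
    have hwalk : ∀ (u v : W) (_ : D.Walk u v), (e.symm u).val ∈ T → (e.symm v).val ∈ T := by
      intro u v w
      induction w with
      | nil => exact id
      | cons hadj _ ih =>
        intro hu
        refine ih (hcl _ hu _ ⟨(e.symm _).2, (e.symm _).2, ?_⟩)
        simpa using hadj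
    obtain ⟨w⟩ := hconn (e ⟨i, hT hi⟩) (e ⟨j, hj⟩)
    simpa using hwalk _ _ w (by simpa using hi)

theorem nonempty_iso_zigzag {o m : ℕ} (ho : o ≤ 1) (hm : o ≤ m) {W : Type*}
    (e : Finset.Ico o (2 * m + 3) ≃ W) :
    Nonempty (SimpleGraph.cycleGraph (2 * m + 3 - o) ≃g
      (zigzag o m).comap (fun w => (e.symm w).val)) := by
  let g : Fin (2 * m + 3 - o) → W := fun k => e ⟨zigzagVertex m (k.val + o), by
    have := k.isLt
    rw [Finset.mem_Ico]
    exact zigzagVertex_mem ho (by omega) (by omega)⟩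
  have hinj : Function.Injective g := by
    intro a b hab
    have := zigzagVertex_injective (by omega) (by omega)
      (congrArg Subtype.val (e.injective hab))
    exact Fin.ext (by omega)
  have : Fintype W := Fintype.ofEquiv _ e
  have hcard : Fintype.card (Fin (2 * m + 3 - o)) = Fintype.card W := by
    rw [← Fintype.card_congr e]; simp
  refine ⟨⟨Equiv.ofBijective g ((Fintype.bijective_iff_injective_and_card g).2 ⟨hinj, hcard⟩), ?_⟩⟩
  intro a b
  have ha := a.isLt
  have hb := b.isLt
  simp only [Equiv.ofBijective_apply, SimpleGraph.comap_adj, g, Equiv.symm_apply_apply]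
  rw [zigzag_adj_zigzagVertex ho hm (by omega) (by omega) (by omega) (by omega),
    cycleGraph_adj_iff (by omega)]
  omega

/-! ### The configuration, and the limit `δ → 0` of the second-order term -/

/-- Distance of the `i`-th point from the vertical axis. -/
noncomputable def mag (i : ℕ) : ℝ := if i = 0 then 0 else if i = 1 then 512 else 8 ^ i

/-- Leading coefficient of the height of the `i`-th point. -/
noncomputable def heightCoeff (i : ℕ) : ℝ :=
  if i = 0 then 1 else if i = 1 then 8 else if i % 2 = 0 then 1 else 11 / 10

/-- Height of the `i`-th point, for the scale parameter `δ`. -/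
noncomputable def height (δ : ℝ) (i : ℕ) : ℝ := heightCoeff i * δ ^ (i / 2)

/-- Edges of `G` join points on opposite sides of the vertical axis. -/
def Alternates (G : SimpleGraph ℕ) : Prop :=
  ∀ i j, G.Adj i j → i = 0 ∨ j = 0 ∨ (i / 2 + j / 2) % 2 = 1

open Classical in
/-- Total cost of the edges from `i` to larger vertices. -/
noncomputable def upCost (c : ℕ → ℕ → ℝ) (S : Finset ℕ) (G : SimpleGraph ℕ) (i : ℕ) : ℝ :=
  ∑ j ∈ S with i < j ∧ G.Adj i j, c i j

/-- Total cost of the edges of a graph on `S`. -/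
noncomputable def cost (c : ℕ → ℕ → ℝ) (S : Finset ℕ) (G : SimpleGraph ℕ) : ℝ :=
  ∑ i ∈ S, upCost c S G i

/-- Twice the second-order term of the length of an edge. -/
noncomputable def secondOrder (δ : ℝ) (i j : ℕ) : ℝ :=
  (height δ i - height δ j) ^ 2 / (mag i + mag j)

/-- The height of the `i`-th point, rescaled by `δ ^ t`, in the limit `δ → 0`. -/
noncomputable def levelHeight (t i : ℕ) : ℝ := if i / 2 = t then heightCoeff i else 0

/-- The limit of `secondOrder`, rescaled by `δ ^ (2 * t)`. -/
noncomputable def levelCost (t i j : ℕ) : ℝ :=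
  (levelHeight t i - levelHeight t j) ^ 2 / (mag i + mag j)

theorem tendsto_height_div {t i : ℕ} (hi : t ≤ i / 2) :
    Tendsto (fun δ : ℝ => height δ i / δ ^ t) (𝓝[>] 0) (𝓝 (levelHeight t i)) := by
  have h1 : Tendsto (fun δ : ℝ => heightCoeff i * δ ^ (i / 2 - t)) (𝓝[>] 0)
      (𝓝 (heightCoeff i * 0 ^ (i / 2 - t))) :=
    ((by fun_prop : Continuous fun δ : ℝ => heightCoeff i * δ ^ (i / 2 - t)).tendsto 0).mono_left
      nhdsWithin_le_nhds
  have h2 : heightCoeff i * (0 : ℝ) ^ (i / 2 - t) = levelHeight t i := by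
    unfold levelHeight
    split_ifs with h
    · simp [h]
    · rw [zero_pow (by omega), mul_zero]
  rw [h2] at h1
  refine h1.congr' ?_
  filter_upwards [self_mem_nhdsWithin] with δ hδ
  have hδ : δ ≠ 0 := ne_of_gt hδ
  unfold height
  rw [mul_div_assoc]
  congr 1
  rw [eq_div_iff (pow_ne_zero _ hδ), ← pow_add]
  congr 1; omega

theorem tendsto_secondOrder_div {t i j : ℕ} (hi : t ≤ i / 2) (hj : t ≤ j / 2) :
    Tendsto (fun δ : ℝ => secondOrder δ i j / δ ^ (2 * t)) (𝓝[>] 0) (𝓝 (levelCost t i j)) := by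
  have h := (((tendsto_height_div hi).sub (tendsto_height_div hj)).pow 2).div_const (mag i + mag j)
  refine h.congr fun δ => ?_
  unfold secondOrder
  rw [← sub_div, div_pow, ← pow_mul, mul_comm t 2, div_right_comm]

open Classical in
theorem tendsto_upCost_div (S : Finset ℕ) (G : SimpleGraph ℕ) {t i : ℕ} (hi : t ≤ i / 2) :
    Tendsto (fun δ : ℝ => upCost (secondOrder δ) S G i / δ ^ (2 * t)) (𝓝[>] 0)
      (𝓝 (upCost (levelCost t) S G i)) := by
  unfold upCost
  simp_rw [Finset.sum_div]
  refine tendsto_finsetSum _ fun j hj => tendsto_secondOrder_div hi ?_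
  have := (Finset.mem_filter.1 hj).2.1
  omega

theorem upCost_congr {c : ℕ → ℕ → ℝ} {S : Finset ℕ} {G H : SimpleGraph ℕ} {i : ℕ}
    (h : ∀ j, G.Adj i j ↔ H.Adj i j) : upCost c S G i = upCost c S H i := by
  unfold upCost
  refine Finset.sum_congr ?_ fun _ _ => rfl
  ext j
  simp [h]

open Classical in
theorem upCost_eq_zero {c : ℕ → ℕ → ℝ} {S : Finset ℕ} {G : SimpleGraph ℕ} {i : ℕ}
    (h : ∀ j, i < j → G.Adj i j → c i j = 0) : upCost c S G i = 0 :=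
  Finset.sum_eq_zero fun j hj => h j (Finset.mem_filter.1 hj).2.1 (Finset.mem_filter.1 hj).2.2

/-- `upCost` charges an edge to its smaller endpoint. If that endpoint lies above level `t`, so does
the other one, and both rescaled heights vanish in the limit; only the two points of level `t`
contribute. -/
theorem sum_upCost_levelCost {S : Finset ℕ} {G : SimpleGraph ℕ}
    (hG : ∀ i j, G.Adj i j → i ∈ S) (t : ℕ) :
    ∑ i ∈ S with t ≤ i / 2, upCost (levelCost t) S G i =
      upCost (levelCost t) S G (2 * t) + upCost (levelCost t) S G (2 * t + 1) := by
  have h1 : ∑ i ∈ S with t ≤ i / 2, upCost (levelCost t) S G i =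
      ∑ i ∈ S ∪ {2 * t, 2 * t + 1} with t ≤ i / 2, upCost (levelCost t) S G i := by
    refine Finset.sum_subset (Finset.filter_subset_filter _ Finset.subset_union_left) ?_
    intro i hi hi'
    refine upCost_eq_zero fun j _ hj => absurd (hG i j hj) fun h => hi' ?_
    exact Finset.mem_filter.2 ⟨h, (Finset.mem_filter.1 hi).2⟩
  rw [h1, ← Finset.sum_pair (by omega)]
  symm
  refine Finset.sum_subset ?_ ?_
  · intro i hi
    simp only [Finset.mem_insert, Finset.mem_singleton] at hi
    simp only [Finset.mem_filter, Finset.mem_union, Finset.mem_insert, Finset.mem_singleton]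
    exact ⟨Or.inr hi, by omega⟩
  · intro i hi hi'
    simp only [Finset.mem_insert, Finset.mem_singleton] at hi'
    have h2 := (Finset.mem_filter.1 hi).2
    refine upCost_eq_zero fun j hj _ => ?_
    unfold levelCost levelHeight
    rw [if_neg (by omega), if_neg (by omega)]
    simp

/-- If two graphs agree below level `t`, then for small `δ` the comparison of their second-order
terms is decided by the level `t`. -/
theorem eventually_cost_lt_of_level {S : Finset ℕ} {G H : SimpleGraph ℕ}
    (hG : ∀ i j, G.Adj i j → i ∈ S) (hH : ∀ i j, H.Adj i j → i ∈ S) {t : ℕ}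
    (hagree : ∀ i < 2 * t, ∀ j, G.Adj i j ↔ H.Adj i j)
    (hlt : upCost (levelCost t) S G (2 * t) + upCost (levelCost t) S G (2 * t + 1) <
      upCost (levelCost t) S H (2 * t) + upCost (levelCost t) S H (2 * t + 1)) :
    ∀ᶠ δ in 𝓝[>] (0 : ℝ), cost (secondOrder δ) S G < cost (secondOrder δ) S H := by
  rw [← sum_upCost_levelCost hG, ← sum_upCost_levelCost hH] at hlt
  have key : ∀ K : SimpleGraph ℕ,
      Tendsto (fun δ : ℝ => ∑ i ∈ S with t ≤ i / 2, upCost (secondOrder δ) S K i / δ ^ (2 * t))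
        (𝓝[>] 0) (𝓝 (∑ i ∈ S with t ≤ i / 2, upCost (levelCost t) S K i)) := fun K =>
    tendsto_finsetSum _ fun i hi => tendsto_upCost_div S K (Finset.mem_filter.1 hi).2
  filter_upwards [(key G).eventually_lt (key H) hlt, self_mem_nhdsWithin] with δ h hδ
  have hδ : (0 : ℝ) < δ := hδ
  rw [← Finset.sum_div, ← Finset.sum_div, div_lt_div_iff_of_pos_right (by positivity)] at h
  unfold cost
  rw [← Finset.sum_filter_add_sum_filter_not S (fun i => t ≤ i / 2),
    ← Finset.sum_filter_add_sum_filter_not (f := upCost _ S H) S (fun i => t ≤ i / 2)]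
  refine add_lt_add_of_lt_of_le h (le_of_eq (Finset.sum_congr rfl fun i hi => ?_))
  have := (Finset.mem_filter.1 hi).2
  exact upCost_congr (hagree i (by omega))

/-! ### Optimality of the zigzag at levels `t ≥ 1` -/

open Classical in
theorem upCost_singleton {c : ℕ → ℕ → ℝ} {S : Finset ℕ} {G : SimpleGraph ℕ} {i k : ℕ}
    (hk : k ∈ S) (hik : i < k) (h : ∀ j, i < j → (G.Adj i j ↔ j = k)) :
    upCost c S G i = c i k := by
  unfold upCost
  rw [Finset.sum_eq_single_of_mem k]
  · simp [hk, hik, h]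
  · intro j hj hjk
    rw [Finset.mem_filter] at hj
    exact absurd ((h j hj.2.1).1 hj.2.2) hjk

open Classical in
theorem upCost_pair {c : ℕ → ℕ → ℝ} {S : Finset ℕ} {G : SimpleGraph ℕ} {i k l : ℕ}
    (hk : k ∈ S) (hik : i < k) (hl : l ∈ S) (hil : i < l) (hkl : k ≠ l)
    (h : ∀ j, i < j → (G.Adj i j ↔ j = k ∨ j = l)) :
    upCost c S G i = c i k + c i l := by
  unfold upCost
  rw [← Finset.sum_pair hkl]
  refine Finset.sum_congr ?_ fun _ _ => rfl
  ext j
  simp only [Finset.mem_filter, Finset.mem_insert, Finset.mem_singleton]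
  constructor
  · rintro ⟨_, h1, h2⟩
    exact (h j h1).1 h2
  · rintro (rfl | rfl)
    · exact ⟨hk, hik, (h _ hik).2 (Or.inl rfl)⟩
    · exact ⟨hl, hil, (h _ hil).2 (Or.inr rfl)⟩

theorem levelCost_of_lt {t i k : ℕ} (hi : i / 2 = t) (hk : t < k / 2) :
    levelCost t i k = heightCoeff i ^ 2 / (mag i + mag k) := by
  unfold levelCost levelHeight
  rw [if_pos hi, if_neg (by omega), sub_zero]

theorem mag_of_two_le {i : ℕ} (hi : 2 ≤ i) : mag i = 8 ^ i := by
  unfold mag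
  rw [if_neg (by omega), if_neg (by omega)]

theorem mag_two_mul_le {t j : ℕ} (ht : 1 ≤ t) (r : ℕ) (hj : 2 * t + r ≤ j) :
    8 ^ r * (8 : ℝ) ^ (2 * t) ≤ mag j := by
  rw [mag_of_two_le (by omega), ← pow_add]
  exact pow_le_pow_right₀ (by norm_num) (by omega)

/-- Among the ways to join the two points of level `t` to distinct later points, the zigzag
is the best. -/
theorem levelCost_add_lt {t j k : ℕ} (ht : 1 ≤ t) (hj : 2 * t + 2 ≤ j) (hk : 2 * t + 2 ≤ k)
    (hjk : j ≠ k) (hne : ¬ (k = 2 * t + 3 ∧ j = 2 * t + 2)) :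
    levelCost t (2 * t) k + levelCost t (2 * t + 1) j <
      levelCost t (2 * t) (2 * t + 3) + levelCost t (2 * t + 1) (2 * t + 2) := by
  rw [levelCost_of_lt (by omega) (by omega), levelCost_of_lt (by omega) (by omega),
    levelCost_of_lt (by omega) (by omega), levelCost_of_lt (by omega) (by omega)]
  have hc0 : heightCoeff (2 * t) = 1 := by
    unfold heightCoeff
    rw [if_neg (by omega), if_neg (by omega), if_pos (by omega)]
  have hc1 : heightCoeff (2 * t + 1) = 11 / 10 := by
    unfold heightCoeff
    rw [if_neg (by omega), if_neg (by omega), if_neg (by omega)]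
  rw [hc0, hc1, mag_of_two_le (by omega : 2 ≤ 2 * t), mag_of_two_le (by omega : 2 ≤ 2 * t + 1),
    mag_of_two_le (by omega : 2 ≤ 2 * t + 2), mag_of_two_le (by omega : 2 ≤ 2 * t + 3),
    pow_add, pow_add, pow_add]
  set z : ℝ := 8 ^ (2 * t) with hz
  have hz0 : 0 < z := by positivity
  by_cases hj2 : j = 2 * t + 2
  · subst hj2
    rw [mag_of_two_le (by omega : 2 ≤ 2 * t + 2), pow_add, ← hz]
    have h := mag_two_mul_le ht 4 (by omega : 2 * t + 4 ≤ k)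
    rw [← hz] at h
    refine add_lt_add_of_lt_of_le (div_lt_div_of_pos_left (by norm_num) (by positivity) ?_) le_rfl
    linarith
  · have h3 := mag_two_mul_le ht 3 (by omega : 2 * t + 3 ≤ j)
    have h2 := mag_two_mul_le ht 2 hk
    rw [← hz] at h2 h3
    have e1 : (1 : ℝ) ^ 2 / (z + mag k) ≤ 1 ^ 2 / (z + 8 ^ 2 * z) :=
      div_le_div_of_nonneg_left (by norm_num) (by positivity) (by linarith)
    have e2 : (11 / 10 : ℝ) ^ 2 / (z * 8 ^ 1 + mag j) ≤ (11 / 10) ^ 2 / (z * 8 ^ 1 + 8 ^ 3 * z) :=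
      div_le_div_of_nonneg_left (by norm_num) (by positivity) (by linarith)
    refine (add_le_add e1 e2).trans_lt ?_
    -- The rival is the swapped matching, inner to `2t+2` and outer to `2t+3`. It loses because the
    -- outer coefficient `c = 11/10` satisfies `c² (1/72 - 1/520) > 1/65 - 1/513`, that is, `c`
    -- exceeds about 1.06; with `c = 1` it would win.
    rw [show z + 8 ^ 2 * z = 65 * z by ring, show z * 8 ^ 1 + 8 ^ 3 * z = 520 * z by ring,
      show z + z * 8 ^ 3 = 513 * z by ring, show z * 8 ^ 1 + z * 8 ^ 2 = 72 * z by ring,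
      ← div_div, ← div_div, ← div_div, ← div_div, ← add_div, ← add_div]
    exact div_lt_div_of_pos_right (by norm_num) hz0

theorem mem_of_zigzag_adj {o m i j : ℕ} (h : (zigzag o m).Adj i j) :
    i ∈ Finset.Ico o (2 * m + 3) := by
  rw [Finset.mem_Ico]
  rcases h with ⟨h1, h2, h3 | h3 | h3 | h3 | h3⟩ | ⟨h1, h2, h3 | h3 | h3 | h3 | h3⟩ <;> omega

theorem zigzag_adj_inner {o m t : ℕ} (ho : o ≤ 1) (ht : 1 ≤ t) (htm : t < m) (j : ℕ) :
    (zigzag o m).Adj (2 * t) j ↔ j = 2 * t - 1 ∨ j = 2 * t + 3 := by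
  rw [zigzag_adj]; unfold ZigzagRel
  constructor
  · rintro (⟨h1, h2, h3 | h3 | h3 | h3 | h3⟩ | ⟨h1, h2, h3 | h3 | h3 | h3 | h3⟩) <;> omega
  · rintro (rfl | rfl)
    · exact Or.inr ⟨by omega, by omega, by omega⟩
    · exact Or.inl ⟨by omega, by omega, by omega⟩

theorem zigzag_adj_inner_last {o m : ℕ} (ho : o ≤ 1) (hm : 1 ≤ m) (j : ℕ) :
    (zigzag o m).Adj (2 * m) j ↔ j = 2 * m - 1 ∨ j = 2 * m + 2 := by
  rw [zigzag_adj]; unfold ZigzagRel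
  constructor
  · rintro (⟨h1, h2, h3 | h3 | h3 | h3 | h3⟩ | ⟨h1, h2, h3 | h3 | h3 | h3 | h3⟩) <;> omega
  · rintro (rfl | rfl)
    · exact Or.inr ⟨by omega, by omega, by omega⟩
    · exact Or.inl ⟨by omega, by omega, by omega⟩

theorem zigzag_adj_outer {o m t : ℕ} (ho : o ≤ 1) (ht : 1 ≤ t) (htm : t ≤ m) (j : ℕ) :
    (zigzag o m).Adj (2 * t + 1) j ↔
      j = (if o = 1 ∧ t = 1 then 1 else 2 * t - 2) ∨ j = 2 * t + 2 := by
  rw [zigzag_adj]; unfold ZigzagRel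
  by_cases h : o = 1 ∧ t = 1
  · rw [if_pos h]
    obtain ⟨rfl, rfl⟩ := h
    constructor
    · rintro (⟨h1, h2, h3 | h3 | h3 | h3 | h3⟩ | ⟨h1, h2, h3 | h3 | h3 | h3 | h3⟩) <;> omega
    · rintro (rfl | rfl)
      · exact Or.inr ⟨by omega, by omega, by omega⟩
      · exact Or.inl ⟨by omega, by omega, by omega⟩
  · rw [if_neg h]
    constructor
    · rintro (⟨h1, h2, h3 | h3 | h3 | h3 | h3⟩ | ⟨h1, h2, h3 | h3 | h3 | h3 | h3⟩) <;> omega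
    · rintro (rfl | rfl)
      · exact Or.inr ⟨by omega, by omega, by omega⟩
      · exact Or.inl ⟨by omega, by omega, by omega⟩

/-- One edge at `i` goes to a lower level, as in the zigzag. The other cannot go lower, by
agreement, nor stay on level `t`, by alternation. -/
theorem exists_upper_neighbor {o m t i d : ℕ} {G : SimpleGraph ℕ}
    (hG : IsCycleOn (Finset.Ico o (2 * m + 3)) G) (halt : Alternates G) (ht : 1 ≤ t)
    (hit : i / 2 = t) (hd : d < 2 * t)
    (hagree : ∀ a < 2 * t, ∀ j, G.Adj a j ↔ (zigzag o m).Adj a j)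
    (hlow : ∀ j < 2 * t, (zigzag o m).Adj i j ↔ j = d) :
    ∃ k, 2 * t + 2 ≤ k ∧ k < 2 * m + 3 ∧ ∀ j, G.Adj i j ↔ j = d ∨ j = k := by
  have hGd : G.Adj i d := ((hagree d hd i).2 ((hlow d hd).2 rfl).symm).symm
  obtain ⟨k, hkd, hk⟩ := hG.exists_other hGd
  have hik : G.Adj i k := (hk k).2 (Or.inr rfl)
  have hk1 : 2 * t ≤ k := by
    by_contra hlt
    push Not at hlt
    exact hkd ((hlow k hlt).1 ((hagree k hlt i).1 hik.symm).symm)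
  have hk2 := Finset.mem_Ico.1 (hG.mem_of_adj hik.symm)
  have := halt i k hik
  exact ⟨k, by omega, hk2.2, hk⟩

/-- Induction step of the greedy argument: either the agreement extends by one level, or the
comparison is already decided at level `t`. -/
theorem agree_or_levelCost_lt {o m t : ℕ} (ho : o ≤ 1) {G : SimpleGraph ℕ}
    (hG : IsCycleOn (Finset.Ico o (2 * m + 3)) G) (halt : Alternates G) (ht : 1 ≤ t) (htm : t ≤ m)
    (hagree : ∀ i < 2 * t, ∀ j, G.Adj i j ↔ (zigzag o m).Adj i j) :
    (∀ i < 2 * t + 2, ∀ j, G.Adj i j ↔ (zigzag o m).Adj i j) ∨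
    upCost (levelCost t) (Finset.Ico o (2 * m + 3)) G (2 * t) +
        upCost (levelCost t) (Finset.Ico o (2 * m + 3)) G (2 * t + 1) <
      upCost (levelCost t) (Finset.Ico o (2 * m + 3)) (zigzag o m) (2 * t) +
        upCost (levelCost t) (Finset.Ico o (2 * m + 3)) (zigzag o m) (2 * t + 1) := by
  obtain ⟨d', hd'⟩ : ∃ d', d' = if o = 1 ∧ t = 1 then 1 else 2 * t - 2 := ⟨_, rfl⟩
  have hd't : d' < 2 * t := by split_ifs at hd' <;> omega
  have hout := zigzag_adj_outer (m := m) ho ht htm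
  rw [← hd'] at hout
  obtain ⟨j, hj1, hj2, hj⟩ := exists_upper_neighbor (i := 2 * t + 1) hG halt ht (by omega) hd't
    hagree (fun j hj => by rw [hout]; omega)
  have hin : ∀ j < 2 * t, (zigzag o m).Adj (2 * t) j ↔ j = 2 * t - 1 := by
    intro j hj
    rcases htm.lt_or_eq with h | h
    · rw [zigzag_adj_inner ho ht h]; omega
    · subst h; rw [zigzag_adj_inner_last ho ht]; omega
  obtain ⟨k, hk1, hk2, hk⟩ := exists_upper_neighbor (i := 2 * t) hG halt ht (by omega)
    (by omega) hagree hin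
  have hext : (∀ l, G.Adj (2 * t) l ↔ (zigzag o m).Adj (2 * t) l) →
      (∀ l, G.Adj (2 * t + 1) l ↔ (zigzag o m).Adj (2 * t + 1) l) →
      ∀ i < 2 * t + 2, ∀ l, G.Adj i l ↔ (zigzag o m).Adj i l := by
    intro h1 h2 i hi l
    rcases (by omega : i < 2 * t ∨ i = 2 * t ∨ i = 2 * t + 1) with h | rfl | rfl
    · exact hagree i h l
    · exact h1 l
    · exact h2 l
  rcases htm.lt_or_eq with h | h
  · have hin' := zigzag_adj_inner ho ht h
    have hjk : j ≠ k := by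
      rintro rfl
      -- A common target `j` would close the cycle on the points up to level `t` together with `j`,
      -- leaving out `2t+2` or `2t+3`.
      have hT : insert j (Finset.Ico o (2 * t + 2)) = Finset.Ico o (2 * m + 3) := by
        refine hG.eq_of_closed _ ?_ ⟨j, Finset.mem_insert_self _ _⟩ ?_
        · intro i hi
          rw [Finset.mem_insert, Finset.mem_Ico] at hi
          rw [Finset.mem_Ico]
          omega
        · intro i hi l hil
          have hl := Finset.mem_Ico.1 (hG.mem_of_adj hil.symm)
          rw [Finset.mem_insert, Finset.mem_Ico] at hi ⊢
          rcases (by omega : i < 2 * t ∨ i = 2 * t ∨ i = 2 * t + 1 ∨ i = j) with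
            h | rfl | rfl | rfl
          · rcases (hagree i h l).1 hil with
              ⟨h1, h2, h3 | h3 | h3 | h3 | h3⟩ | ⟨h1, h2, h3 | h3 | h3 | h3 | h3⟩ <;> omega
          · have := (hk l).1 hil; omega
          · have := (hj l).1 hil; omega
          · obtain ⟨a, b, hab, hN⟩ := hG.neighborSet_eq_pair i (hG.mem_of_adj hil)
            have h1 := (hN _).1 ((hk i).2 (Or.inr rfl)).symm
            have h2 := (hN _).1 ((hj i).2 (Or.inr rfl)).symm
            have h3 := (hN _).1 hil
            omega
      have h1 : 2 * t + 2 ∈ Finset.Ico o (2 * m + 3) := Finset.mem_Ico.2 (by omega)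
      have h2 : 2 * t + 3 ∈ Finset.Ico o (2 * m + 3) := Finset.mem_Ico.2 (by omega)
      rw [← hT, Finset.mem_insert, Finset.mem_Ico] at h1 h2
      omega
    by_cases hopt : k = 2 * t + 3 ∧ j = 2 * t + 2
    · left
      refine hext (fun l => ?_) (fun l => ?_)
      · rw [hk, hin', hopt.1]
      · rw [hj, hout, hopt.2]
    · right
      rw [upCost_singleton (k := k) (Finset.mem_Ico.2 (by omega)) (by omega)
          (fun l hl => by rw [hk]; omega),
        upCost_singleton (k := j) (Finset.mem_Ico.2 (by omega)) (by omega)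
          (fun l hl => by rw [hj]; omega),
        upCost_singleton (k := 2 * t + 3) (Finset.mem_Ico.2 (by omega)) (by omega)
          (fun l hl => by rw [hin']; omega),
        upCost_singleton (k := 2 * t + 2) (Finset.mem_Ico.2 (by omega)) (by omega)
          (fun l hl => by rw [hout]; omega)]
      exact levelCost_add_lt ht hj1 hk1 hjk hopt
  -- At the top level `t = m` only the point `2m+2` remains, so both edges are forced.
  · left
    subst h
    refine hext (fun l => ?_) (fun l => ?_)
    · rw [hk, zigzag_adj_inner_last ho ht, show k = 2 * t + 2 by omega]
    · rw [hj, hout, show j = 2 * t + 2 by omega]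

/-! ### Optimality of the zigzag at level 0 -/

theorem mag_two : mag 2 = 64 := by rw [mag_of_two_le le_rfl]; norm_num

theorem mag_three : mag 3 = 512 := by rw [mag_of_two_le (by norm_num)]; norm_num

theorem mag_zero : mag 0 = 0 := by simp [mag]

theorem mag_one : mag 1 = 512 := by simp [mag]

theorem le_mag_of_two_le {i : ℕ} (hi : 2 ≤ i) : 64 ≤ mag i := by
  rw [mag_of_two_le hi]
  calc (64 : ℝ) = 8 ^ 2 := by norm_num
    _ ≤ 8 ^ i := pow_le_pow_right₀ (by norm_num) hi

theorem le_mag_of_three_le {i : ℕ} (hi : 3 ≤ i) : 512 ≤ mag i := by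
  rw [mag_of_two_le (by omega)]
  calc (512 : ℝ) = 8 ^ 3 := by norm_num
    _ ≤ 8 ^ i := pow_le_pow_right₀ (by norm_num) hi

theorem lt_mag_of_four_le {i : ℕ} (hi : 4 ≤ i) : 512 < mag i := by
  rw [mag_of_two_le (by omega)]
  calc (512 : ℝ) < 8 ^ 4 := by norm_num
    _ ≤ 8 ^ i := pow_le_pow_right₀ (by norm_num) hi

theorem levelCost_zero_zero {k : ℕ} (hk : 2 ≤ k) : levelCost 0 0 k = 1 / mag k := by
  rw [levelCost_of_lt (by omega) (by omega), mag_zero]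
  simp [heightCoeff]

theorem levelCost_zero_one {k : ℕ} (hk : 2 ≤ k) : levelCost 0 1 k = 64 / (512 + mag k) := by
  rw [levelCost_of_lt (by omega) (by omega), mag_one]
  simp [heightCoeff]; norm_num

theorem levelCost_zero_zero_one : levelCost 0 0 1 = 49 / 512 := by
  unfold levelCost levelHeight heightCoeff
  rw [mag_zero, mag_one]
  norm_num

theorem levelCost_zero_zero_le_of_two_le {k : ℕ} (hk : 2 ≤ k) : levelCost 0 0 k ≤ 1 / 64 := by
  rw [levelCost_zero_zero hk]
  exact div_le_div_of_nonneg_left (by norm_num) (by norm_num) (le_mag_of_two_le hk)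

theorem levelCost_zero_zero_le_of_three_le {k : ℕ} (hk : 3 ≤ k) : levelCost 0 0 k ≤ 1 / 512 := by
  rw [levelCost_zero_zero (by omega)]
  exact div_le_div_of_nonneg_left (by norm_num) (by norm_num) (le_mag_of_three_le hk)

theorem levelCost_zero_zero_lt_of_four_le {k : ℕ} (hk : 4 ≤ k) : levelCost 0 0 k < 1 / 512 := by
  rw [levelCost_zero_zero (by omega)]
  exact div_lt_div_of_pos_left (by norm_num) (by norm_num) (lt_mag_of_four_le hk)

theorem levelCost_zero_one_le_of_two_le {k : ℕ} (hk : 2 ≤ k) : levelCost 0 1 k ≤ 1 / 9 := by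
  rw [levelCost_zero_one hk, div_le_div_iff₀ (by linarith [le_mag_of_two_le hk]) (by norm_num)]
  linarith [le_mag_of_two_le hk]

theorem levelCost_zero_one_le_of_three_le {k : ℕ} (hk : 3 ≤ k) : levelCost 0 1 k ≤ 1 / 16 := by
  rw [levelCost_zero_one (by omega),
    div_le_div_iff₀ (by linarith [le_mag_of_three_le hk]) (by norm_num)]
  linarith [le_mag_of_three_le hk]

theorem levelCost_zero_one_lt_of_four_le {k : ℕ} (hk : 4 ≤ k) : levelCost 0 1 k < 1 / 16 := by
  rw [levelCost_zero_one (by omega),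
    div_lt_div_iff₀ (by linarith [lt_mag_of_four_le hk]) (by norm_num)]
  linarith [lt_mag_of_four_le hk]

theorem levelCost_zero_zero_three : levelCost 0 0 3 = 1 / 512 := by
  rw [levelCost_zero_zero (by norm_num), mag_three]

theorem levelCost_zero_one_two : levelCost 0 1 2 = 1 / 9 := by
  rw [levelCost_zero_one le_rfl, mag_two]; norm_num

theorem levelCost_zero_one_three : levelCost 0 1 3 = 1 / 16 := by
  rw [levelCost_zero_one (by norm_num), mag_three]; norm_num

/-- Two distinct neighbors, in increasing order. -/
theorem IsCycleOn.exists_lt {S : Finset ℕ} {G : SimpleGraph ℕ} (hG : IsCycleOn S G) {i : ℕ}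
    (hi : i ∈ S) : ∃ a b, a < b ∧ ∀ j, G.Adj i j ↔ j = a ∨ j = b := by
  obtain ⟨a, b, hab, h⟩ := hG.neighborSet_eq_pair i hi
  rcases lt_or_gt_of_ne hab with hlt | hlt
  · exact ⟨a, b, hlt, h⟩
  · exact ⟨b, a, hlt, fun j => (h j).trans or_comm⟩

/-- Point `1` is alone on its level, so both its edges go up. Its cost decreases with the distance
of the target, hence `2` and `3` are best. -/
theorem agree_or_levelCost_lt_zero_even {m : ℕ} (hm : 1 ≤ m) {G : SimpleGraph ℕ}
    (hG : IsCycleOn (Finset.Ico 1 (2 * m + 3)) G) :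
    (∀ i < 2, ∀ j, G.Adj i j ↔ (zigzag 1 m).Adj i j) ∨
    upCost (levelCost 0) (Finset.Ico 1 (2 * m + 3)) G 0 +
        upCost (levelCost 0) (Finset.Ico 1 (2 * m + 3)) G 1 <
      upCost (levelCost 0) (Finset.Ico 1 (2 * m + 3)) (zigzag 1 m) 0 +
        upCost (levelCost 0) (Finset.Ico 1 (2 * m + 3)) (zigzag 1 m) 1 := by
  have h0 : ∀ j, ¬ G.Adj 0 j := fun j hj => by
    have := Finset.mem_Ico.1 (hG.mem_of_adj hj); omega
  have hz0 : ∀ j, ¬ (zigzag 1 m).Adj 0 j := fun j hj => by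
    have := Finset.mem_Ico.1 (mem_of_zigzag_adj hj); omega
  have hz1 : ∀ j, (zigzag 1 m).Adj 1 j ↔ j = 2 ∨ j = 3 := by
    intro j
    rw [zigzag_adj]; unfold ZigzagRel
    constructor
    · rintro (⟨h1, h2, h3 | h3 | h3 | h3 | h3⟩ | ⟨h1, h2, h3 | h3 | h3 | h3 | h3⟩) <;> omega
    · rintro (rfl | rfl)
      · exact Or.inl ⟨by omega, by omega, by omega⟩
      · exact Or.inl ⟨by omega, by omega, by omega⟩
  obtain ⟨a, b, hab, hN⟩ := hG.exists_lt (i := 1) (Finset.mem_Ico.2 (by omega))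
  have ha := Finset.mem_Ico.1 (hG.mem_of_adj ((hN a).2 (Or.inl rfl)).symm)
  have hb := Finset.mem_Ico.1 (hG.mem_of_adj ((hN b).2 (Or.inr rfl)).symm)
  have ha1 : a ≠ 1 := ((hN a).2 (Or.inl rfl)).ne'
  by_cases h : a = 2 ∧ b = 3
  · left
    intro i hi j
    interval_cases i
    · exact iff_of_false (h0 j) (hz0 j)
    · rw [hN, hz1, h.1, h.2]
  · right
    rw [upCost_eq_zero fun j _ hj => absurd hj (h0 j),
      upCost_eq_zero fun j _ hj => absurd hj (hz0 j),
      upCost_pair (Finset.mem_Ico.2 ha) (by omega) (Finset.mem_Ico.2 hb) (by omega) hab.ne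
        (fun j _ => hN j),
      upCost_pair (k := 2) (l := 3) (Finset.mem_Ico.2 (by omega)) (by omega)
        (Finset.mem_Ico.2 (by omega)) (by omega) (by omega) (fun j _ => hz1 j),
      levelCost_zero_one_two, levelCost_zero_one_three]
    have := levelCost_zero_one_le_of_two_le (by omega : 2 ≤ a)
    have := levelCost_zero_one_lt_of_four_le (by omega : 4 ≤ b)
    linarith

/-- Since `0` lies on the axis, the edge from `0` to `1` is allowed although it stays on one level.
Its cost 49/512 is so large that it must be used; then `1` takes `2` and `0` takes `3`, as at higher
levels. -/
theorem agree_or_levelCost_lt_zero_odd {m : ℕ} {G : SimpleGraph ℕ}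
    (hG : IsCycleOn (Finset.Ico 0 (2 * m + 3)) G) :
    (∀ i < 2, ∀ j, G.Adj i j ↔ (zigzag 0 m).Adj i j) ∨
    upCost (levelCost 0) (Finset.Ico 0 (2 * m + 3)) G 0 +
        upCost (levelCost 0) (Finset.Ico 0 (2 * m + 3)) G 1 <
      upCost (levelCost 0) (Finset.Ico 0 (2 * m + 3)) (zigzag 0 m) 0 +
        upCost (levelCost 0) (Finset.Ico 0 (2 * m + 3)) (zigzag 0 m) 1 := by
  have hz0 : ∀ j, (zigzag 0 m).Adj 0 j ↔ j = 1 ∨ j = if m = 0 then 2 else 3 := by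
    intro j
    rw [zigzag_adj]; unfold ZigzagRel
    by_cases hm : m = 0
    · rw [if_pos hm]
      subst hm; omega
    · rw [if_neg hm]
      constructor
      · rintro (⟨h1, h2, h3 | h3 | h3 | h3 | h3⟩ | ⟨h1, h2, h3 | h3 | h3 | h3 | h3⟩) <;> omega
      · rintro (rfl | rfl)
        · exact Or.inl ⟨by omega, by omega, by omega⟩
        · exact Or.inl ⟨by omega, by omega, by omega⟩
  have hz1 : ∀ j, (zigzag 0 m).Adj 1 j ↔ j = 0 ∨ j = 2 := by
    intro j
    rw [zigzag_adj]; unfold ZigzagRel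
    constructor
    · rintro (⟨h1, h2, h3 | h3 | h3 | h3 | h3⟩ | ⟨h1, h2, h3 | h3 | h3 | h3 | h3⟩) <;> omega
    · rintro (rfl | rfl)
      · exact Or.inr ⟨by omega, by omega, by omega⟩
      · exact Or.inl ⟨by omega, by omega, by omega⟩
  have hmem : ∀ {i j}, G.Adj i j → j < 2 * m + 3 := fun h =>
    (Finset.mem_Ico.1 (hG.mem_of_adj h.symm)).2
  have hzcost : 1 ≤ m → upCost (levelCost 0) (Finset.Ico 0 (2 * m + 3)) (zigzag 0 m) 0 +
      upCost (levelCost 0) (Finset.Ico 0 (2 * m + 3)) (zigzag 0 m) 1 =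
      49 / 512 + 1 / 512 + 1 / 9 := by
    intro hm
    rw [if_neg (by omega : m ≠ 0)] at hz0
    rw [upCost_pair (k := 1) (l := 3) (Finset.mem_Ico.2 (by omega)) (by omega)
        (Finset.mem_Ico.2 (by omega)) (by omega) (by omega) (fun j _ => hz0 j),
      upCost_singleton (k := 2) (Finset.mem_Ico.2 (by omega)) (by omega)
        (fun l hl => by rw [hz1]; omega),
      levelCost_zero_zero_one, levelCost_zero_zero_three, levelCost_zero_one_two]
  by_cases h01 : G.Adj 0 1
  · obtain ⟨k, hk1, hk⟩ := hG.exists_other h01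
    obtain ⟨j, hj1, hj⟩ := hG.exists_other h01.symm
    have hk0 : k ≠ 0 := ((hk k).2 (Or.inr rfl)).ne'
    have hj0 : j ≠ 1 := ((hj j).2 (Or.inr rfl)).ne'
    have hkm := hmem ((hk k).2 (Or.inr rfl))
    have hjm := hmem ((hj j).2 (Or.inr rfl))
    have hopt : (k = if m = 0 then 2 else 3) → j = 2 →
        ∀ i < 2, ∀ j, G.Adj i j ↔ (zigzag 0 m).Adj i j := by
      intro h1 h2 i hi l
      interval_cases i
      · rw [hk, hz0, h1]
      · rw [hj, hz1, h2]
    rcases Nat.eq_zero_or_pos m with rfl | hm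
    · exact Or.inl (hopt (by rw [if_pos rfl]; omega) (by omega))
    rw [if_neg (by omega : m ≠ 0)] at hopt
    have hjk : j ≠ k := by
      rintro rfl
      have hT : insert j {0, 1} = Finset.Ico 0 (2 * m + 3) := by
        refine hG.eq_of_closed _ ?_ ⟨j, Finset.mem_insert_self _ _⟩ ?_
        · intro i hi
          simp only [Finset.mem_insert, Finset.mem_singleton] at hi
          rw [Finset.mem_Ico]
          omega
        · intro i hi l hil
          simp only [Finset.mem_insert, Finset.mem_singleton] at hi ⊢
          rcases hi with rfl | rfl | rfl
          · obtain ⟨a, b, hab, hN⟩ := hG.neighborSet_eq_pair i (hG.mem_of_adj hil)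
            have h1 := (hN _).1 ((hk i).2 (Or.inr rfl)).symm
            have h2 := (hN _).1 ((hj i).2 (Or.inr rfl)).symm
            have h3 := (hN _).1 hil
            omega
          · have := (hk l).1 hil; omega
          · have := (hj l).1 hil; omega
      have h1 : 2 ∈ Finset.Ico 0 (2 * m + 3) := Finset.mem_Ico.2 (by omega)
      have h2 : 3 ∈ Finset.Ico 0 (2 * m + 3) := Finset.mem_Ico.2 (by omega)
      rw [← hT] at h1 h2
      simp only [Finset.mem_insert, Finset.mem_singleton] at h1 h2
      omega
    by_cases h : k = 3 ∧ j = 2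
    · exact Or.inl (hopt h.1 h.2)
    · right
      rw [hzcost hm, upCost_pair (k := 1) (l := k) (Finset.mem_Ico.2 (by omega)) (by omega)
          (Finset.mem_Ico.2 (by omega)) (by omega) hk1.symm (fun j _ => hk j),
        upCost_singleton (k := j) (Finset.mem_Ico.2 (by omega)) (by omega)
          (fun l hl => by rw [hj]; omega), levelCost_zero_zero_one]
      -- If `1` keeps `2`, then `0` misses `3` and loses strictly. Otherwise the total is at most
      -- 49/512 + 1/16 + 1/64, below the zigzag's 49/512 + 1/9 + 1/512.
      by_cases hj2 : j = 2
      · have := levelCost_zero_one_le_of_two_le (by omega : 2 ≤ j)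
        have := levelCost_zero_zero_lt_of_four_le (by omega : 4 ≤ k)
        linarith
      · have := levelCost_zero_one_le_of_three_le (by omega : 3 ≤ j)
        have := levelCost_zero_zero_le_of_two_le (by omega : 2 ≤ k)
        linarith
  · obtain ⟨k, k', hkk, hk⟩ := hG.exists_lt (i := 0) (Finset.mem_Ico.2 (by omega))
    obtain ⟨j, j', hjj, hj⟩ := hG.exists_lt (i := 1) (Finset.mem_Ico.2 (by omega))
    have ak := (hk k).2 (Or.inl rfl)
    have ak' := (hk k').2 (Or.inr rfl)
    have aj := (hj j).2 (Or.inl rfl)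
    have aj' := (hj j').2 (Or.inr rfl)
    have hk2 : 2 ≤ k := by
      rcases (by omega : k = 0 ∨ k = 1 ∨ 2 ≤ k) with rfl | rfl | h
      · exact absurd rfl ak.ne
      · exact absurd ak h01
      · exact h
    have hj2 : 2 ≤ j := by
      rcases (by omega : j = 0 ∨ j = 1 ∨ 2 ≤ j) with rfl | rfl | h
      · exact absurd aj.symm h01
      · exact absurd rfl aj.ne
      · exact h
    have hkm := hmem ak'
    have hjm := hmem aj'
    right
    rw [hzcost (by omega), upCost_pair (Finset.mem_Ico.2 (by omega)) (by omega)
        (Finset.mem_Ico.2 (by omega)) (by omega) hkk.ne (fun j _ => hk j),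
      upCost_pair (Finset.mem_Ico.2 (by omega)) (by omega)
        (Finset.mem_Ico.2 (by omega)) (by omega) hjj.ne (fun l _ => hj l)]
    -- Without the edge from `0` to `1` the total is at most 1/9 + 1/16 + 1/64 + 1/512, less than
    -- 1/9 + 50/512.
    have := levelCost_zero_one_le_of_two_le hj2
    have := levelCost_zero_one_le_of_three_le (by omega : 3 ≤ j')
    have := levelCost_zero_zero_le_of_two_le hk2
    have := levelCost_zero_zero_le_of_three_le (by omega : 3 ≤ k')
    linarith

/-- Among the alternating cycles the zigzag has the largest second-order term, for small `δ`. -/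
theorem eventually_cost_secondOrder_lt {o m : ℕ} (ho : o ≤ 1) (hm : o ≤ m) {G : SimpleGraph ℕ}
    (hG : IsCycleOn (Finset.Ico o (2 * m + 3)) G) (halt : Alternates G) (hne : G ≠ zigzag o m) :
    ∀ᶠ δ in 𝓝[>] (0 : ℝ), cost (secondOrder δ) (Finset.Ico o (2 * m + 3)) G <
      cost (secondOrder δ) (Finset.Ico o (2 * m + 3)) (zigzag o m) := by
  by_contra hcon
  have hlevel : ∀ t, (∀ i < 2 * t, ∀ j, G.Adj i j ↔ (zigzag o m).Adj i j) → ¬ _ := fun t h h' =>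
    hcon (eventually_cost_lt_of_level (fun i j h => hG.mem_of_adj h)
      (fun i j h => mem_of_zigzag_adj h) (t := t) h h')
  have key : ∀ t, t ≤ m + 1 → ∀ i < 2 * t, ∀ j, G.Adj i j ↔ (zigzag o m).Adj i j := by
    intro t
    induction t with
    | zero => intro _ i hi; omega
    | succ t ih =>
      intro ht
      have h := ih (by omega)
      rcases Nat.eq_zero_or_pos t with rfl | ht0
      · interval_cases o
        · exact (agree_or_levelCost_lt_zero_odd hG).resolve_right (hlevel 0 h)
        · exact (agree_or_levelCost_lt_zero_even hm hG).resolve_right (hlevel 0 h)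
      · exact (agree_or_levelCost_lt ho hG halt ht0 (by omega) h).resolve_right (hlevel t h)
  -- Agreement on all points below `2m+2` is equality of graphs, as an edge cannot have `2m+2` at
  -- both ends.
  apply hne
  ext i j
  rcases lt_or_ge i (2 * m + 2) with hi | hi
  · exact key (m + 1) le_rfl i (by omega) j
  rcases lt_or_ge j (2 * m + 2) with hj | hj
  · rw [G.adj_comm, (zigzag o m).adj_comm]
    exact key (m + 1) le_rfl j (by omega) i
  · refine iff_of_false (fun h => ?_) (fun h => ?_)
    · have h1 := Finset.mem_Ico.1 (hG.mem_of_adj h)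
      have h2 := Finset.mem_Ico.1 (hG.mem_of_adj h.symm)
      exact h.ne (by omega)
    · have h1 := Finset.mem_Ico.1 (mem_of_zigzag_adj h)
      have h2 := Finset.mem_Ico.1 (mem_of_zigzag_adj h.symm)
      exact h.ne (by omega)

/-! ### Expansion of the length in `s`: alternating cycles and their derivative -/

/-- Abscissa of the `i`-th point. -/
noncomputable def abscissa (i : ℕ) : ℝ := (-1) ^ (i / 2) * mag i

/-- Length of the edge joining two points, when the heights are multiplied by `√s`. -/
noncomputable def segmentLength (δ s : ℝ) (i j : ℕ) : ℝ :=
  √((abscissa i - abscissa j) ^ 2 + s * (height δ i - height δ j) ^ 2)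

theorem mag_nonneg (i : ℕ) : 0 ≤ mag i := by
  unfold mag; split_ifs <;> positivity

theorem mag_pos {i : ℕ} (hi : i ≠ 0) : 0 < mag i := by
  unfold mag; rw [if_neg hi]; split_ifs <;> positivity

theorem abs_abscissa (i : ℕ) : |abscissa i| = mag i := by
  unfold abscissa
  rw [abs_mul, abs_pow, abs_neg, abs_one, one_pow, one_mul, abs_of_nonneg (mag_nonneg i)]

theorem abs_abscissa_sub_le (i j : ℕ) : |abscissa i - abscissa j| ≤ mag i + mag j := by
  rw [← abs_abscissa i, ← abs_abscissa j]
  exact abs_sub _ _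

theorem abs_abscissa_sub_of_odd {i j : ℕ} (h : (i / 2 + j / 2) % 2 = 1) :
    |abscissa i - abscissa j| = mag i + mag j := by
  unfold abscissa
  have : ((-1 : ℝ)) ^ (j / 2) = -(-1) ^ (i / 2) := by
    rcases Nat.even_or_odd (i / 2) with h1 | h1
    · have h2 : Odd (j / 2) := by rw [Nat.odd_iff]; rw [Nat.even_iff] at h1; omega
      rw [h1.neg_one_pow, h2.neg_one_pow]
    · have h2 : Even (j / 2) := by rw [Nat.even_iff]; rw [Nat.odd_iff] at h1; omega
      rw [h1.neg_one_pow, h2.neg_one_pow, neg_neg]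
  rw [this, neg_mul, sub_neg_eq_add, ← mul_add, abs_mul, abs_pow, abs_neg, abs_one, one_pow,
    one_mul, abs_of_nonneg (add_nonneg (mag_nonneg i) (mag_nonneg j))]

theorem abs_abscissa_sub_of_even {i j : ℕ} (h : (i / 2 + j / 2) % 2 = 0) (hi : i ≠ 0)
    (hj : j ≠ 0) : |abscissa i - abscissa j| < mag i + mag j := by
  unfold abscissa
  have : ((-1 : ℝ)) ^ (j / 2) = (-1) ^ (i / 2) := by
    rcases Nat.even_or_odd (i / 2) with h1 | h1
    · have h2 : Even (j / 2) := by rw [Nat.even_iff] at *; omega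
      rw [h1.neg_one_pow, h2.neg_one_pow]
    · have h2 : Odd (j / 2) := by rw [Nat.odd_iff] at *; omega
      rw [h1.neg_one_pow, h2.neg_one_pow]
  rw [this, ← mul_sub, abs_mul, abs_pow, abs_neg, abs_one, one_pow, one_mul, abs_lt]
  constructor <;> linarith [mag_pos hi, mag_pos hj]

theorem Alternates.abs_abscissa_sub {G : SimpleGraph ℕ} (hG : Alternates G) {i j : ℕ}
    (h : G.Adj i j) : |abscissa i - abscissa j| = mag i + mag j := by
  rcases hG i j h with rfl | rfl | h
  · rw [show abscissa 0 = 0 by simp [abscissa, mag_zero], mag_zero, zero_sub, abs_neg,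
      abs_abscissa, zero_add]
  · rw [show abscissa 0 = 0 by simp [abscissa, mag_zero], mag_zero, sub_zero, abs_abscissa,
      add_zero]
  · exact abs_abscissa_sub_of_odd h

theorem alternates_zigzag {o m : ℕ} : Alternates (zigzag o m) := by
  intro i j h
  rcases h with ⟨h1, h2, h3 | h3 | h3 | h3 | h3⟩ | ⟨h1, h2, h3 | h3 | h3 | h3 | h3⟩ <;> omega

theorem transportGraph_comap_zigzag {o m : ℕ} {W : Type*}
    (e : Finset.Ico o (2 * m + 3) ≃ W) :
    transportGraph e ((zigzag o m).comap (fun w => (e.symm w).val)) = zigzag o m := by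
  ext i j
  constructor
  · rintro ⟨hi, hj, h⟩
    simpa using h
  · intro h
    exact ⟨mem_of_zigzag_adj h, mem_of_zigzag_adj h.symm, by simpa using h⟩

theorem isCycleOn_zigzag {o m : ℕ} (ho : o ≤ 1) (hm : o ≤ m) :
    IsCycleOn (Finset.Ico o (2 * m + 3)) (zigzag o m) := by
  obtain ⟨f⟩ := nonempty_iso_zigzag ho hm (Equiv.refl _)
  rw [← transportGraph_comap_zigzag (Equiv.refl _)]
  exact isCycleOn_transportGraph _ _ (by omega) f

open Classical in
/-- In a cycle every vertex is counted twice. -/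
theorem IsCycleOn.cost_add {S : Finset ℕ} {G : SimpleGraph ℕ} (hG : IsCycleOn S G) (a : ℕ → ℝ) :
    cost (fun i j => a i + a j) S G = ∑ i ∈ S, 2 * a i := by
  unfold cost upCost
  simp_rw [Finset.sum_filter]
  have h1 : ∑ i ∈ S, ∑ j ∈ S, (if i < j ∧ G.Adj i j then a i + a j else 0) =
      ∑ i ∈ S, ∑ j ∈ S, (if i < j ∧ G.Adj i j then a i else 0) +
      ∑ i ∈ S, ∑ j ∈ S, (if j < i ∧ G.Adj i j then a i else 0) := by
    rw [Finset.sum_comm (f := fun i j => if j < i ∧ G.Adj i j then a i else 0),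
      ← Finset.sum_add_distrib]
    refine Finset.sum_congr rfl fun i _ => ?_
    rw [← Finset.sum_add_distrib]
    refine Finset.sum_congr rfl fun j _ => ?_
    rw [G.adj_comm j i]
    split_ifs <;> simp
  rw [h1, ← Finset.sum_add_distrib]
  refine Finset.sum_congr rfl fun i hi => ?_
  rw [← Finset.sum_add_distrib]
  obtain ⟨p, q, hpq, hN⟩ := hG.neighborSet_eq_pair i hi
  have h2 : ∑ j ∈ S, ((if i < j ∧ G.Adj i j then a i else 0) +
      (if j < i ∧ G.Adj i j then a i else 0)) = ∑ j ∈ S with G.Adj i j, a i := by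
    rw [Finset.sum_filter]
    refine Finset.sum_congr rfl fun j _ => ?_
    by_cases h : G.Adj i j
    · rcases lt_or_gt_of_ne h.ne with hlt | hlt <;> simp [h, hlt, hlt.le]
    · simp [h]
  rw [h2]
  have h3 : {j ∈ S | G.Adj i j} = {p, q} := by
    ext j
    simp only [Finset.mem_filter, Finset.mem_insert, Finset.mem_singleton]
    rw [hN]
    exact and_iff_right_of_imp fun h => hG.mem_of_adj ((hN j).2 h).symm
  rw [h3, Finset.sum_pair hpq, two_mul]

open Classical in
theorem upCost_le {c d : ℕ → ℕ → ℝ} {S : Finset ℕ} {G : SimpleGraph ℕ} {i : ℕ}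
    (h : ∀ j, i < j → G.Adj i j → c i j ≤ d i j) : upCost c S G i ≤ upCost d S G i :=
  Finset.sum_le_sum fun j hj => h j (Finset.mem_filter.1 hj).2.1 (Finset.mem_filter.1 hj).2.2

open Classical in
theorem upCost_congr_cost {c d : ℕ → ℕ → ℝ} {S : Finset ℕ} {G : SimpleGraph ℕ} {i : ℕ}
    (h : ∀ j, i < j → G.Adj i j → c i j = d i j) : upCost c S G i = upCost d S G i :=
  Finset.sum_congr rfl fun j hj => h j (Finset.mem_filter.1 hj).2.1 (Finset.mem_filter.1 hj).2.2

theorem segmentLength_zero (δ : ℝ) (i j : ℕ) :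
    segmentLength δ 0 i j = |abscissa i - abscissa j| := by
  unfold segmentLength
  rw [zero_mul, add_zero, Real.sqrt_sq_eq_abs]

theorem IsCycleOn.cost_segmentLength_zero {S : Finset ℕ} {G : SimpleGraph ℕ}
    (hG : IsCycleOn S G) (halt : Alternates G) (δ : ℝ) :
    cost (segmentLength δ 0) S G = ∑ i ∈ S, 2 * mag i := by
  rw [← hG.cost_add]
  refine Finset.sum_congr rfl fun i _ => upCost_congr_cost fun j _ h => ?_
  rw [segmentLength_zero, halt.abs_abscissa_sub h]

open Classical in
theorem IsCycleOn.cost_segmentLength_zero_lt {S : Finset ℕ} {G : SimpleGraph ℕ}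
    (hG : IsCycleOn S G) (halt : ¬ Alternates G) (δ : ℝ) :
    cost (segmentLength δ 0) S G < ∑ i ∈ S, 2 * mag i := by
  rw [← hG.cost_add]
  have hle : ∀ i j, segmentLength δ 0 i j ≤ mag i + mag j := fun i j => by
    rw [segmentLength_zero]; exact abs_abscissa_sub_le i j
  have hex : ∃ i j, i < j ∧ G.Adj i j ∧ segmentLength δ 0 i j < mag i + mag j := by
    unfold Alternates at halt
    push Not at halt
    obtain ⟨i, j, h, hi, hj, hij⟩ := halt
    rcases lt_or_gt_of_ne h.ne with hlt | hlt
    · exact ⟨i, j, hlt, h, by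
        rw [segmentLength_zero]; exact abs_abscissa_sub_of_even (by omega) hi hj⟩
    · exact ⟨j, i, hlt, h.symm, by
        rw [segmentLength_zero]; exact abs_abscissa_sub_of_even (by omega) hj hi⟩
  obtain ⟨i, j, hij, h, hlt⟩ := hex
  refine Finset.sum_lt_sum (fun i _ => upCost_le fun j _ _ => hle i j) ⟨i, hG.mem_of_adj h, ?_⟩
  refine Finset.sum_lt_sum (fun j _ => hle i j) ⟨j, ?_, hlt⟩
  exact Finset.mem_filter.2 ⟨hG.mem_of_adj h.symm, hij, h⟩

open Classical in
theorem continuous_cost_segmentLength (S : Finset ℕ) (G : SimpleGraph ℕ) (δ : ℝ) :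
    Continuous fun s => cost (segmentLength δ s) S G := by
  unfold cost upCost segmentLength
  fun_prop

/-- The derivative of `√(A² + s B²)` at `s = 0` is `B² / (2A)`. Scaling heights by `√s` rather than
`s` makes this first-order in `s`. -/
theorem hasDerivAt_segmentLength {δ : ℝ} {i j : ℕ}
    (h : |abscissa i - abscissa j| = mag i + mag j) (hpos : 0 < mag i + mag j) :
    HasDerivAt (fun s => segmentLength δ s i j) (secondOrder δ i j / 2) 0 := by
  unfold segmentLength secondOrder
  have hne : (abscissa i - abscissa j) ^ 2 + 0 * (height δ i - height δ j) ^ 2 ≠ 0 := by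
    rw [← sq_abs, h]
    positivity
  have h1 : HasDerivAt (fun s : ℝ => (abscissa i - abscissa j) ^ 2 +
      s * (height δ i - height δ j) ^ 2) (1 * (height δ i - height δ j) ^ 2) 0 :=
    ((hasDerivAt_id (0 : ℝ)).mul_const _).const_add _
  convert h1.sqrt hne using 1
  rw [zero_mul, add_zero, Real.sqrt_sq_eq_abs, h, one_mul, div_div, mul_comm]

open Classical in
theorem Alternates.hasDerivAt_cost {S : Finset ℕ} {G : SimpleGraph ℕ} (halt : Alternates G)
    (δ : ℝ) : HasDerivAt (fun s => cost (segmentLength δ s) S G)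
      (cost (secondOrder δ) S G / 2) 0 := by
  unfold cost upCost
  simp_rw [Finset.sum_div]
  refine HasDerivAt.fun_sum fun i _ => HasDerivAt.fun_sum fun j hj => ?_
  obtain ⟨_, hij, h⟩ := Finset.mem_filter.1 hj
  exact hasDerivAt_segmentLength (halt.abs_abscissa_sub h)
    (add_pos_of_nonneg_of_pos (mag_nonneg i) (mag_pos (by omega)))

theorem HasDerivAt.eventually_lt_right {f g : ℝ → ℝ} {f' g' a : ℝ} (hf : HasDerivAt f f' a)
    (hg : HasDerivAt g g' a) (h0 : f a = g a) (h : f' < g') : ∀ᶠ x in 𝓝[>] a, f x < g x := by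
  have h1 := (hasDerivAt_iff_tendsto_slope.1 (hg.sub hf)).mono_left
    (nhdsWithin_mono a (fun x (hx : a < x) => hx.ne' : Set.Ioi a ⊆ {a}ᶜ))
  filter_upwards [h1.eventually_const_lt (sub_pos.2 h), self_mem_nhdsWithin] with x hx hxa
  have hxa : a < x := hxa
  rw [slope_def_field, Pi.sub_apply, Pi.sub_apply, h0, sub_self, sub_zero] at hx
  have := (div_pos_iff_of_pos_right (sub_pos.2 hxa)).1 hx
  linarith

/-- Alternating cycles tie with the zigzag at `s = 0` and lose by their derivative; the others
already lose at `s = 0`, and continuity preserves the strict inequality. -/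
theorem eventually_cost_segmentLength_lt {o m : ℕ} (ho : o ≤ 1) (hm : o ≤ m) {δ : ℝ}
    {G : SimpleGraph ℕ} (hG : IsCycleOn (Finset.Ico o (2 * m + 3)) G)
    (h : Alternates G → cost (secondOrder δ) (Finset.Ico o (2 * m + 3)) G <
      cost (secondOrder δ) (Finset.Ico o (2 * m + 3)) (zigzag o m)) :
    ∀ᶠ s in 𝓝[>] (0 : ℝ), cost (segmentLength δ s) (Finset.Ico o (2 * m + 3)) G <
      cost (segmentLength δ s) (Finset.Ico o (2 * m + 3)) (zigzag o m) := by
  have hz := (isCycleOn_zigzag ho hm).cost_segmentLength_zero alternates_zigzag δ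
  by_cases halt : Alternates G
  · refine (halt.hasDerivAt_cost δ).eventually_lt_right (alternates_zigzag.hasDerivAt_cost δ) ?_ ?_
    · rw [hz, hG.cost_segmentLength_zero halt]
    · linarith [h halt]
  · refine Filter.Eventually.filter_mono nhdsWithin_le_nhds ?_
    refine ((continuous_cost_segmentLength _ G δ).tendsto 0).eventually_lt
      ((continuous_cost_segmentLength _ (zigzag o m) δ).tendsto 0) ?_
    rw [hz]
    exact hG.cost_segmentLength_zero_lt halt δ

/-! ### The zigzag is noncrossing -/

/-- The point number `i`. -/
noncomputable def planePoint (δ s : ℝ) (i : ℕ) : Plane := !₂[abscissa i, √s * height δ i]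

/-- The segments `ij` and `kl` are weakly separated by a line that does not contain `ij`. -/
def Separated (δ : ℝ) (i j k l : ℕ) : Prop :=
  ∃ α β γ : ℝ, 0 ≤ α * abscissa i + β * height δ i + γ ∧ 0 ≤ α * abscissa j + β * height δ j + γ ∧
    0 < (α * abscissa i + β * height δ i + γ) + (α * abscissa j + β * height δ j + γ) ∧
    α * abscissa k + β * height δ k + γ ≤ 0 ∧ α * abscissa l + β * height δ l + γ ≤ 0

/-- The affine function is positive on the first open segment and nonpositive on the second. It is
stated in unscaled coordinates, since the vertical scaling by `√s > 0` does not affect incidences.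
-/
theorem Separated.disjoint {δ s : ℝ} (hs : 0 < s) {i j k l : ℕ} (h : Separated δ i j k l) :
    Disjoint (openSegment ℝ (planePoint δ s i) (planePoint δ s j))
      (openSegment ℝ (planePoint δ s k) (planePoint δ s l)) := by
  obtain ⟨α, β, γ, hi, hj, hij, hk, hl⟩ := h
  rw [Set.disjoint_left]
  rintro p ⟨a, b, ha, hb, hab, rfl⟩ ⟨c, d, hc, hd, hcd, h⟩
  have h0 := congrArg (fun q : Plane => q 0) h
  have h1 := congrArg (fun q : Plane => q 1) h
  simp only [planePoint, PiLp.add_apply, PiLp.smul_apply, smul_eq_mul, Matrix.cons_val_zero,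
    Matrix.cons_val_one] at h0 h1
  have hs' : √s ≠ 0 := (Real.sqrt_pos.2 hs).ne'
  have h2 : c * height δ k + d * height δ l = a * height δ i + b * height δ j := by
    apply mul_left_cancel₀ hs'
    linear_combination h1
  have e1 : 0 < a * (α * abscissa i + β * height δ i + γ) +
      b * (α * abscissa j + β * height δ j + γ) := by
    rcases hi.lt_or_eq with h | h
    · exact add_pos_of_pos_of_nonneg (mul_pos ha h) (mul_nonneg hb.le hj)
    · rw [← h, zero_add] at hij
      rw [← h, mul_zero, zero_add]
      exact mul_pos hb hij
  have e2 : c * (α * abscissa k + β * height δ k + γ) +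
      d * (α * abscissa l + β * height δ l + γ) ≤ 0 :=
    add_nonpos (mul_nonpos_of_nonneg_of_nonpos hc.le hk) (mul_nonpos_of_nonneg_of_nonpos hd.le hl)
  have e3 : c * (α * abscissa k + β * height δ k + γ) +
      d * (α * abscissa l + β * height δ l + γ) = a * (α * abscissa i + β * height δ i + γ) +
      b * (α * abscissa j + β * height δ j + γ) := by
    linear_combination α * h0 + β * h2 + γ * hcd - γ * hab
  linarith

theorem separated_of_height {δ c : ℝ} {i j k l : ℕ} (hi : c ≤ height δ i) (hj : c ≤ height δ j)
    (hij : c < height δ i ∨ c < height δ j) (hk : height δ k ≤ c) (hl : height δ l ≤ c) :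
    Separated δ i j k l :=
  ⟨0, 1, -c, by linarith, by linarith, by rcases hij with h | h <;> linarith, by linarith,
    by linarith⟩

theorem one_le_heightCoeff (i : ℕ) : 1 ≤ heightCoeff i := by
  unfold heightCoeff; split_ifs <;> norm_num

theorem heightCoeff_le (i : ℕ) : heightCoeff i ≤ 8 := by
  unfold heightCoeff; split_ifs <;> norm_num

theorem height_lt_of_level_lt {δ : ℝ} (h0 : 0 < δ) (h1 : δ ≤ 1 / 100) {i j : ℕ}
    (h : i / 2 < j / 2) : height δ j < height δ i := by
  unfold height
  calc heightCoeff j * δ ^ (j / 2) ≤ 8 * δ ^ (i / 2 + 1) :=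
        mul_le_mul (heightCoeff_le j) (pow_le_pow_of_le_one h0.le (by linarith) h)
          (by positivity) (by norm_num)
    _ = (8 * δ) * δ ^ (i / 2) := by ring
    _ < 1 * δ ^ (i / 2) := mul_lt_mul_of_pos_right (by linarith) (by positivity)
    _ ≤ heightCoeff i * δ ^ (i / 2) :=
        mul_le_mul_of_nonneg_right (one_le_heightCoeff i) (by positivity)

theorem height_inner (δ : ℝ) (t : ℕ) : height δ (2 * t) = δ ^ t := by
  unfold height heightCoeff
  rw [show 2 * t / 2 = t by omega]
  split_ifs <;> first | omega | ring

theorem height_outer (δ : ℝ) {t : ℕ} (ht : 1 ≤ t) :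
    height δ (2 * t + 1) = 11 / 10 * δ ^ t := by
  unfold height heightCoeff
  rw [show (2 * t + 1) / 2 = t by omega, if_neg (by omega), if_neg (by omega), if_neg (by omega)]

theorem height_one (δ : ℝ) : height δ 1 = 8 := by
  simp [height, heightCoeff]

theorem height_inner_lt_outer {δ : ℝ} (h0 : 0 < δ) (t : ℕ) :
    height δ (2 * t) < height δ (2 * t + 1) := by
  rw [height_inner]
  rcases Nat.eq_zero_or_pos t with rfl | ht
  · rw [mul_zero, zero_add, height_one]; norm_num
  · rw [height_outer δ ht]
    have : 0 < δ ^ t := by positivity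
    linarith

/-- An affine function of the points that vanishes on the edge from `2t+1` to `2t+2`. -/
noncomputable def lineValue (δ : ℝ) (t p : ℕ) : ℝ :=
  (height δ p - height δ (2 * t + 2)) * (mag (2 * t + 1) + mag (2 * t + 2)) -
    (height δ (2 * t + 1) - height δ (2 * t + 2)) * ((-1) ^ t * abscissa p + mag (2 * t + 2))

theorem neg_one_pow_mul_self (t : ℕ) : (-1 : ℝ) ^ t * (-1) ^ t = 1 := by
  rw [← pow_add, Even.neg_one_pow ⟨t, rfl⟩]

theorem neg_one_pow_mul_abscissa {t p : ℕ} (h : p / 2 = t) : (-1) ^ t * abscissa p = mag p := by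
  unfold abscissa
  rw [h, ← mul_assoc, neg_one_pow_mul_self, one_mul]

theorem neg_one_pow_mul_abscissa_succ {t p : ℕ} (h : p / 2 = t + 1) :
    (-1) ^ t * abscissa p = -mag p := by
  unfold abscissa
  rw [h, pow_succ, ← mul_assoc, ← mul_assoc, neg_one_pow_mul_self]
  ring

theorem neg_one_pow_succ_mul_abscissa {t p : ℕ} (h : p / 2 = t) :
    (-1) ^ (t + 1) * abscissa p = -mag p := by
  unfold abscissa
  rw [h, pow_succ]
  linear_combination (-mag p) * neg_one_pow_mul_self t

theorem lineValue_outer (δ : ℝ) (t : ℕ) : lineValue δ t (2 * t + 1) = 0 := by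
  unfold lineValue
  rw [neg_one_pow_mul_abscissa (by omega)]
  ring

theorem lineValue_inner_succ (δ : ℝ) (t : ℕ) : lineValue δ t (2 * t + 2) = 0 := by
  unfold lineValue
  rw [neg_one_pow_mul_abscissa_succ (by omega)]
  ring

/-- The edge from `2t+1` to `2t+2` passes just below the point `2t`. For `t ≥ 1` and small `δ` this
requires `c * 65/72 < 1` for the outer coefficient `c`, so `c` must stay below about 1.107; `11/10`
meets this bound and the one from `levelCost_add_lt`. For `t = 0` the height at the axis is near `8
* 64/576 < 1`. -/
theorem lineValue_inner_pos {δ : ℝ} (h0 : 0 < δ) (h1 : δ ≤ 1 / 100) (t : ℕ) :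
    0 < lineValue δ t (2 * t) := by
  unfold lineValue
  rw [neg_one_pow_mul_abscissa (by omega), height_inner, show 2 * t + 2 = 2 * (t + 1) by ring,
    height_inner]
  rcases Nat.eq_zero_or_pos t with rfl | ht
  · simp only [mul_zero, zero_add, mul_one]
    rw [height_one, mag_one, mag_two, mag_zero]
    linarith
  · rw [height_outer δ ht, mag_of_two_le (by omega : 2 ≤ 2 * t),
      mag_of_two_le (by omega : 2 ≤ 2 * t + 1), mag_of_two_le (by omega : 2 ≤ 2 * (t + 1))]
    rw [show 2 * (t + 1) = 2 * t + 2 by ring, pow_add, pow_add, pow_succ δ]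
    have : 0 < δ ^ t * (8 : ℝ) ^ (2 * t) * (1 / 2 - 7 * δ) :=
      mul_pos (by positivity) (by linarith)
    linear_combination this

/-- The line descends towards `2t+2`; the point `2t+3` is higher than `2t+2` and lies beyond it,
where the line is lower still. -/
theorem lineValue_outer_succ_pos {δ : ℝ} (h0 : 0 < δ) (h1 : δ ≤ 1 / 100) (t : ℕ) :
    0 < lineValue δ t (2 * t + 3) := by
  unfold lineValue
  rw [neg_one_pow_mul_abscissa_succ (by omega)]
  have e1 := height_inner_lt_outer h0 (t + 1)
  have e2 : height δ (2 * t + 2) < height δ (2 * t + 1) := height_lt_of_level_lt h0 h1 (by omega)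
  have e3 : mag (2 * t + 2) < mag (2 * t + 3) := by
    rw [mag_of_two_le (by omega), mag_of_two_le (by omega)]
    exact pow_lt_pow_right₀ (by norm_num) (by omega)
  have e4 := mul_pos (sub_pos.2 e1) (add_pos (mag_pos (by omega : 2 * t + 1 ≠ 0))
    (mag_pos (by omega : 2 * t + 2 ≠ 0)))
  have e5 := mul_pos (sub_pos.2 e2) (sub_pos.2 e3)
  rw [show 2 * (t + 1) + 1 = 2 * t + 3 by ring, show 2 * (t + 1) = 2 * t + 2 by ring] at e4
  linarith

/-- On the side of `2t+1` the line from `2t+3` to `2t+4` has descended below the height of `2t+3`,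
which is itself below `2t+1`. -/
theorem lineValue_succ_outer_pos {δ : ℝ} (h0 : 0 < δ) (h1 : δ ≤ 1 / 100) (t : ℕ) :
    0 < lineValue δ (t + 1) (2 * t + 1) := by
  unfold lineValue
  rw [neg_one_pow_succ_mul_abscissa (by omega)]
  have e1 : height δ (2 * (t + 1) + 1) < height δ (2 * t + 1) :=
    height_lt_of_level_lt h0 h1 (by omega)
  have e2 : height δ (2 * (t + 1) + 2) < height δ (2 * (t + 1) + 1) :=
    height_lt_of_level_lt h0 h1 (by omega)
  have e4 := mul_pos (sub_pos.2 e1) (add_pos (mag_pos (by omega : 2 * (t + 1) + 1 ≠ 0))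
    (mag_pos (by omega : 2 * (t + 1) + 2 ≠ 0)))
  have e5 := mul_pos (sub_pos.2 e2) (add_pos (mag_pos (by omega : 2 * (t + 1) + 1 ≠ 0))
    (mag_pos (by omega : 2 * t + 1 ≠ 0)))
  linarith

theorem separated_of_lineValue {δ : ℝ} (t : ℕ) {i j : ℕ} (hi : 0 ≤ lineValue δ t i)
    (hj : 0 ≤ lineValue δ t j) (hij : 0 < lineValue δ t i ∨ 0 < lineValue δ t j) :
    Separated δ i j (2 * t + 1) (2 * t + 2) := by
  have key : ∀ p, -(height δ (2 * t + 1) - height δ (2 * t + 2)) * (-1) ^ t * abscissa p +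
      (mag (2 * t + 1) + mag (2 * t + 2)) * height δ p +
      (-height δ (2 * t + 2) * (mag (2 * t + 1) + mag (2 * t + 2)) -
        (height δ (2 * t + 1) - height δ (2 * t + 2)) * mag (2 * t + 2)) = lineValue δ t p := by
    intro p; unfold lineValue; ring
  refine ⟨_, _, _, (key i).symm ▸ hi, (key j).symm ▸ hj, ?_, ?_, ?_⟩
  · rw [key, key]; rcases hij with h | h <;> linarith
  · rw [key, lineValue_outer]
  · rw [key, lineValue_inner_succ]

/-- Apart from the edge `0, 1`, each edge joins consecutive levels. Edges far apart in level are
separated by a horizontal line; otherwise the line through an edge from an outer point to the next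
inner one may be needed. -/
theorem separated_of_zigzagRel {δ : ℝ} (h0 : 0 < δ) (h1 : δ ≤ 1 / 100) {o m i j k l : ℕ}
    (ho : o ≤ 1) (hij : ZigzagRel o m i j) (hkl : ZigzagRel o m k l)
    (hlt : i < k ∨ i = k ∧ j < l) : Separated δ i j k l ∨ Separated δ k l i j := by
  have hj : j / 2 = i / 2 + 1 ∨ i = 0 ∧ j = 1 := by
    obtain ⟨-, -, h | h | h | h | h⟩ := hij <;> omega
  have hl : l / 2 = k / 2 + 1 ∨ k = 0 ∧ l = 1 := by
    obtain ⟨-, -, h | h | h | h | h⟩ := hkl <;> omega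
  have hlev : ∀ {p q : ℕ}, p / 2 < q / 2 → height δ q < height δ p :=
    fun h => height_lt_of_level_lt h0 h1 h
  rcases hj with hj | ⟨rfl, rfl⟩
  · have hl' : l / 2 = k / 2 + 1 := by omega
    rcases (by omega : i / 2 + 1 < k / 2 ∨ k / 2 = i / 2 + 1 ∨ k / 2 = i / 2) with h | h | h
    · left
      exact separated_of_height (c := height δ j) (hlev (by omega)).le le_rfl
        (Or.inl (hlev (by omega))) (hlev (by omega)).le (hlev (by omega)).le
    · by_cases hjk : height δ k ≤ height δ j
      · left
        exact separated_of_height (c := height δ j) (hlev (by omega)).le le_rfl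
          (Or.inl (hlev (by omega))) hjk (hlev (by omega)).le
      -- The horizontal line fails only if `k` is the outer and `j` the inner point of the same
      -- level. The edges are then `2t+1, 2t+2` and `2t+3, 2t+4`, and the line through the latter
      -- separates.
      · obtain ⟨t, ht⟩ : ∃ t, i / 2 = t := ⟨_, rfl⟩
        have hk3 : k = 2 * t + 3 := by
          by_contra hk3
          apply hjk
          obtain rfl : k = 2 * (t + 1) := by omega
          rcases (by omega : j = 2 * (t + 1) ∨ j = 2 * (t + 1) + 1) with rfl | rfl
          · exact le_rfl
          · exact (height_inner_lt_outer h0 _).le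
        have hj2 : j = 2 * t + 2 := by
          by_contra hj2
          exact hjk (le_of_eq (by rw [show j = k by omega]))
        have hi1 : i = 2 * t + 1 := by
          obtain ⟨-, g1, g | g | g | g | g⟩ := hij <;>
            obtain ⟨-, g2, g' | g' | g' | g' | g'⟩ := hkl <;> omega
        have hl4 : l = 2 * t + 4 := by
          obtain ⟨-, g2, g' | g' | g' | g' | g'⟩ := hkl <;> omega
        subst hk3 hj2 hi1 hl4
        left
        exact separated_of_lineValue (t + 1) (lineValue_succ_outer_pos h0 h1 t).le
          (lineValue_inner_pos h0 h1 (t + 1)).le (Or.inl (lineValue_succ_outer_pos h0 h1 t))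
    · obtain ⟨t, ht⟩ : ∃ t, i / 2 = t := ⟨_, rfl⟩
      rcases hlt with hlt | ⟨rfl, hlt⟩
      · obtain rfl : i = 2 * t := by omega
        obtain rfl : k = 2 * t + 1 := by omega
        left
        have hli := lineValue_inner_pos h0 h1 t
        have hljnn : 0 ≤ lineValue δ t j := by
          rcases (by omega : j = 2 * t + 2 ∨ j = 2 * t + 3) with rfl | rfl
          · exact (lineValue_inner_succ δ t).ge
          · exact (lineValue_outer_succ_pos h0 h1 t).le
        have hl2 : l = 2 * t + 2 := by
          obtain ⟨g0, g1, g | g | g | g | g⟩ := hij <;>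
            obtain ⟨-, g2, g' | g' | g' | g' | g'⟩ := hkl <;> omega
        subst hl2
        exact separated_of_lineValue t hli.le hljnn (Or.inl hli)
      -- Only for `o = 1` do two upward edges start at the same point.
      · have : i = 1 ∧ j = 2 ∧ l = 3 := by
          obtain ⟨-, g1, g | g | g | g | g⟩ := hij <;>
            obtain ⟨-, g2, g' | g' | g' | g' | g'⟩ := hkl <;> omega
        obtain ⟨rfl, rfl, rfl⟩ := this
        right
        exact separated_of_lineValue 0 (lineValue_outer δ 0).ge
          (lineValue_outer_succ_pos h0 h1 0).le (Or.inr (lineValue_outer_succ_pos h0 h1 0))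
  · left
    by_cases hk : k = 1
    · subst hk
      have hl2 : l = 2 := by
        obtain ⟨g0, -⟩ := hij
        obtain ⟨-, g2, g' | g' | g' | g' | g'⟩ := hkl <;> omega
      subst hl2
      exact separated_of_lineValue 0 (lineValue_inner_pos h0 h1 0).le (lineValue_outer δ 0).ge
        (Or.inl (lineValue_inner_pos h0 h1 0))
    · refine separated_of_height (c := height δ 0) le_rfl (height_inner_lt_outer h0 0).le
        (Or.inr (height_inner_lt_outer h0 0)) ?_ (hlev (by omega)).le
      rcases Nat.eq_zero_or_pos k with rfl | hk0
      · exact le_rfl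
      · exact (hlev (by omega)).le

theorem noncrossing_zigzag {δ s : ℝ} (h0 : 0 < δ) (h1 : δ ≤ 1 / 100) (hs : 0 < s) {o m : ℕ}
    (ho : o ≤ 1) {i j k l : ℕ} (hij : (zigzag o m).Adj i j) (hkl : (zigzag o m).Adj k l)
    (hne : s(i, j) ≠ s(k, l)) :
    Disjoint (openSegment ℝ (planePoint δ s i) (planePoint δ s j))
      (openSegment ℝ (planePoint δ s k) (planePoint δ s l)) := by
  have main : ∀ {i j k l : ℕ}, ZigzagRel o m i j → ZigzagRel o m k l → s(i, j) ≠ s(k, l) →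
      Disjoint (openSegment ℝ (planePoint δ s i) (planePoint δ s j))
        (openSegment ℝ (planePoint δ s k) (planePoint δ s l)) := by
    intro i j k l hij hkl hne
    have hne' : ¬ (i = k ∧ j = l) := fun h => hne (by rw [h.1, h.2])
    rcases (by omega : (i < k ∨ i = k ∧ j < l) ∨ (k < i ∨ k = i ∧ l < j)) with h | h
    · rcases separated_of_zigzagRel h0 h1 ho hij hkl h with h | h
      · exact h.disjoint hs
      · exact (h.disjoint hs).symm
    · rcases separated_of_zigzagRel h0 h1 ho hkl hij h with h | h
      · exact (h.disjoint hs).symm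
      · exact h.disjoint hs
  rcases hij with hij | hij <;> rcases hkl with hkl | hkl
  · exact main hij hkl hne
  · rw [openSegment_symm ℝ (planePoint δ s k)]
    exact main hij hkl (by rwa [Sym2.eq_swap (a := l)])
  · rw [openSegment_symm ℝ (planePoint δ s i)]
    exact main hij hkl (by rwa [Sym2.eq_swap (a := j)])
  · rw [openSegment_symm ℝ (planePoint δ s i), openSegment_symm ℝ (planePoint δ s k)]
    exact main hij hkl (by rwa [Sym2.eq_swap (a := j), Sym2.eq_swap (a := l)])

/-! ### Passage to the plane and choice of parameters -/

theorem planePoint_injective (δ s : ℝ) : Function.Injective (planePoint δ s) := by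
  intro i j h
  have h0 : abscissa i = abscissa j := by
    have := congrArg (fun q : Plane => q 0) h
    simpa [planePoint] using this
  by_contra hij
  have hm : mag i = mag j := by rw [← abs_abscissa, h0, abs_abscissa]
  have main : ∀ {i j : ℕ}, i < j → abscissa i = abscissa j → mag i = mag j → False := by
    intro i j hlt ha hm
    have hj : 0 < mag j := mag_pos (by omega)
    have hi : i ≠ 0 := by rintro rfl; rw [mag_zero] at hm; linarith
    rcases (by omega : i = 1 ∨ 2 ≤ i) with rfl | hi2
    · rcases (by omega : j = 2 ∨ j = 3 ∨ 4 ≤ j) with rfl | rfl | hj4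
      · rw [mag_one, mag_two] at hm; norm_num at hm
      -- Points `1` and `3` are equally far from the axis, but on opposite sides.
      · norm_num [abscissa, mag_one, mag_three] at ha
      · rw [mag_one] at hm
        exact (lt_mag_of_four_le hj4).ne hm
    · rw [mag_of_two_le hi2, mag_of_two_le (by omega)] at hm
      exact (pow_lt_pow_right₀ (by norm_num) hlt).ne hm
  rcases lt_or_gt_of_ne hij with hlt | hlt
  · exact main hlt h0 hm
  · exact main hlt h0.symm hm.symm

theorem dist_planePoint {δ s : ℝ} (hs : 0 ≤ s) (i j : ℕ) :
    dist (planePoint δ s i) (planePoint δ s j) = segmentLength δ s i j := by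
  rw [EuclideanSpace.dist_eq, Fin.sum_univ_two]
  simp only [planePoint, Matrix.cons_val_zero, Matrix.cons_val_one, Real.dist_eq, sq_abs]
  unfold segmentLength
  rw [← mul_sub, mul_pow, Real.sq_sqrt hs]

open Classical in
theorem graphLength_eq_cost {P : Finset Plane} {S : Finset ℕ} (e : S ≃ P) {c : ℕ → ℕ → ℝ}
    (hc : ∀ i j : S, dist (e i : Plane) (e j : Plane) = c i j) (D : SimpleGraph P) :
    graphLength D = cost c S (transportGraph e D) := by
  unfold cost upCost graphLength
  rw [Finset.sum_sigma']
  symm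
  refine Finset.sum_bij (fun x hx => s(e ⟨x.1, (Finset.mem_sigma.1 hx).1⟩,
    e ⟨x.2, (Finset.mem_filter.1 (Finset.mem_sigma.1 hx).2).1⟩)) ?_ ?_ ?_ ?_
  · rintro ⟨i, j⟩ hx
    obtain ⟨hi, hj⟩ := Finset.mem_sigma.1 hx
    obtain ⟨hj, hlt, hi', hj', h⟩ := Finset.mem_filter.1 hj
    rw [SimpleGraph.mem_edgeFinset, SimpleGraph.mem_edgeSet]
    exact h
  · rintro ⟨i, j⟩ hx ⟨k, l⟩ hy h
    obtain ⟨hi, hj⟩ := Finset.mem_sigma.1 hx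
    obtain ⟨hj, hij, -⟩ := Finset.mem_filter.1 hj
    obtain ⟨hk, hl⟩ := Finset.mem_sigma.1 hy
    obtain ⟨hl, hkl, -⟩ := Finset.mem_filter.1 hl
    simp only [Sym2.eq_iff, EmbeddingLike.apply_eq_iff_eq, Subtype.mk.injEq] at h
    dsimp only at hij hkl
    rcases h with ⟨rfl, rfl⟩ | ⟨rfl, rfl⟩
    · rfl
    · omega
  · intro b
    induction b with | _ u v
    intro hb
    rw [SimpleGraph.mem_edgeFinset, SimpleGraph.mem_edgeSet] at hb
    have hne : (e.symm u).val ≠ (e.symm v).val := fun h =>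
      hb.ne (e.symm.injective (Subtype.ext h))
    rcases lt_or_gt_of_ne hne with hlt | hlt
    · refine ⟨⟨(e.symm u).val, (e.symm v).val⟩, Finset.mem_sigma.2 ⟨(e.symm u).2,
        Finset.mem_filter.2 ⟨(e.symm v).2, hlt, (e.symm u).2, (e.symm v).2, by simpa using hb⟩⟩, ?_⟩
      simp
    · refine ⟨⟨(e.symm v).val, (e.symm u).val⟩, Finset.mem_sigma.2 ⟨(e.symm v).2,
        Finset.mem_filter.2 ⟨(e.symm u).2, hlt, (e.symm v).2, (e.symm u).2,
          by simpa using hb.symm⟩⟩, ?_⟩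
      simp [Sym2.eq_swap]
  · rintro ⟨i, j⟩ hx
    exact (hc ⟨i, (Finset.mem_sigma.1 hx).1⟩
      ⟨j, (Finset.mem_filter.1 (Finset.mem_sigma.1 hx).2).1⟩).symm

theorem transportGraph_injective {S : Finset ℕ} {W : Type*} (e : S ≃ W) {D E : SimpleGraph W}
    (h : transportGraph e D = transportGraph e E) : D = E := by
  ext u v
  have h1 : ∀ K : SimpleGraph W, (transportGraph e K).Adj (e.symm u).val (e.symm v).val ↔
      K.Adj u v := fun K =>
    ⟨fun ⟨_, _, h⟩ => by simpa using h, fun h => ⟨(e.symm u).2, (e.symm v).2, by simpa using h⟩⟩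
  rw [← h1, ← h1, h]

theorem transportGraph_comap {S : Finset ℕ} {W : Type*} (e : S ≃ W) (D : SimpleGraph W) :
    transportGraph (Equiv.refl S) (D.comap e) = transportGraph e D := rfl

/-- For suitable parameters, the zigzag is the only longest cycle. -/
theorem exists_parameters {o m : ℕ} (ho : o ≤ 1) (hm : o ≤ m) :
    ∃ δ s : ℝ, 0 < δ ∧ δ ≤ 1 / 100 ∧ 0 < s ∧
      ∀ H : SimpleGraph (Finset.Ico o (2 * m + 3)),
        IsCycleOn (Finset.Ico o (2 * m + 3)) (transportGraph (Equiv.refl _) H) →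
        transportGraph (Equiv.refl _) H ≠ zigzag o m →
        cost (segmentLength δ s) (Finset.Ico o (2 * m + 3)) (transportGraph (Equiv.refl _) H) <
          cost (segmentLength δ s) (Finset.Ico o (2 * m + 3)) (zigzag o m) := by
  have h1 : ∀ᶠ δ in 𝓝[>] (0 : ℝ), ∀ H : SimpleGraph (Finset.Ico o (2 * m + 3)),
      IsCycleOn (Finset.Ico o (2 * m + 3)) (transportGraph (Equiv.refl _) H) →
      transportGraph (Equiv.refl _) H ≠ zigzag o m →
      Alternates (transportGraph (Equiv.refl _) H) →
      cost (secondOrder δ) (Finset.Ico o (2 * m + 3)) (transportGraph (Equiv.refl _) H) <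
          cost (secondOrder δ) (Finset.Ico o (2 * m + 3)) (zigzag o m) := by
    -- Only finitely many graphs live on the finite index set, so one `δ` serves them all; this is
    -- why `H` is not a graph on `ℕ`.
    simp only [Filter.eventually_all]
    exact fun H hH hne halt => eventually_cost_secondOrder_lt ho hm hH halt hne
  have h2 : ∀ᶠ δ in 𝓝[>] (0 : ℝ), δ ∈ Set.Ioc (0 : ℝ) (1 / 100) :=
    Ioc_mem_nhdsGT (by norm_num)
  obtain ⟨δ, hδ, hδ0, hδ1⟩ := (h1.and h2).exists
  have h3 : ∀ᶠ s in 𝓝[>] (0 : ℝ), ∀ H : SimpleGraph (Finset.Ico o (2 * m + 3)),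
      IsCycleOn (Finset.Ico o (2 * m + 3)) (transportGraph (Equiv.refl _) H) →
      transportGraph (Equiv.refl _) H ≠ zigzag o m →
      cost (segmentLength δ s) (Finset.Ico o (2 * m + 3)) (transportGraph (Equiv.refl _) H) <
        cost (segmentLength δ s) (Finset.Ico o (2 * m + 3)) (zigzag o m) := by
    simp only [Filter.eventually_all]
    exact fun H hH hne => eventually_cost_segmentLength_lt ho hm hH (hδ H hH hne)
  obtain ⟨s, hs, hs0⟩ := (h3.and self_mem_nhdsWithin).exists
  exact ⟨δ, s, hδ0, hδ1, hs0, hs⟩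

theorem exists_unique_longest_noncrossing (n : ℕ) (hn : 3 ≤ n) :
    ∃ P : Finset Plane, P.card = n ∧ ∃ C : SimpleGraph P, IsLongestSpanningCycle C ∧
      (∀ D : SimpleGraph P, IsLongestSpanningCycle D → D = C) ∧ IsNoncrossing C := by
  obtain ⟨o, m, ho, hm, rfl⟩ : ∃ o m : ℕ, o ≤ 1 ∧ o ≤ m ∧ n = 2 * m + 3 - o := by
    rcases Nat.even_or_odd' n with ⟨k, h | h⟩
    · exact ⟨1, k - 1, le_rfl, by omega, by omega⟩
    · exact ⟨0, k - 1, by omega, by omega, by omega⟩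
  obtain ⟨δ, s, hδ0, hδ1, hs0, hopt⟩ := exists_parameters ho hm
  set S := Finset.Ico o (2 * m + 3) with hS
  let p : ℕ ↪ Plane := ⟨planePoint δ s, planePoint_injective δ s⟩
  have hcard : (S.map p).card = 2 * m + 3 - o := by rw [Finset.card_map, hS, Nat.card_Ico]
  let e : S ≃ S.map p := S.equivMap p
  have he : ∀ i : S, (e i : Plane) = planePoint δ s i := fun _ => rfl
  have hlen := graphLength_eq_cost e (c := segmentLength δ s)
    (fun i j => by rw [he, he, dist_planePoint hs0.le])
  let C : SimpleGraph (S.map p) := (zigzag o m).comap (fun w => (e.symm w).val)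
  have hC : transportGraph e C = zigzag o m := transportGraph_comap_zigzag e
  have hCspan : IsSpanningCycle C := by
    refine ⟨by omega, ?_⟩
    rw [hcard]
    exact nonempty_iso_zigzag ho hm e
  have hlt : ∀ D : SimpleGraph (S.map p), IsSpanningCycle D → D ≠ C →
      graphLength D < graphLength C := by
    intro D ⟨h3, ⟨f⟩⟩ hne
    rw [hlen, hlen, hC]
    have := hopt (D.comap e)
    rw [transportGraph_comap] at this
    exact this (isCycleOn_transportGraph e D h3 f)
      fun h => hne (transportGraph_injective e (h.trans hC.symm))
  have hlong : IsLongestSpanningCycle C := by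
    refine ⟨hCspan, fun D hD => ?_⟩
    by_cases h : D = C
    · rw [h]
    · exact (hlt D hD h).le
  refine ⟨S.map p, hcard, C, hlong, fun D hD => ?_, ?_⟩
  · by_contra h
    exact absurd (hD.2 C hCspan) (not_le.2 (hlt D hD.1 h))
  · intro a b c d hab hcd hne
    have hpt : ∀ w : S.map p, (w : Plane) = planePoint δ s (e.symm w).val := fun w => by
      rw [← he, Equiv.apply_symm_apply]
    rw [hpt a, hpt b, hpt c, hpt d]
    refine noncrossing_zigzag hδ0 hδ1 hs0 ho hab hcd fun h => hne ?_
    have hinj : Function.Injective fun w : S.map p => (e.symm w).val :=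
      Subtype.val_injective.comp e.symm.injective
    exact Sym2.map.injective hinj h

theorem mainTheorem2 :
    (∀ n : ℕ, 3 ≤ n → ∃ P : Finset Plane, P.card = n ∧
      ∃ C : SimpleGraph P, IsLongestSpanningCycle C ∧
        (∀ D : SimpleGraph P, IsLongestSpanningCycle D → D = C) ∧ IsNoncrossing C) ∧
    ¬ ∃ N : ℕ, ∀ P : Finset Plane, N ≤ P.card →
      ∃ C : SimpleGraph P, IsLongestSpanningCycle C ∧ ¬ IsNoncrossing C := by
  refine ⟨exists_unique_longest_noncrossing, ?_⟩
  rintro ⟨N, hN⟩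
  obtain ⟨P, hP, C, -, huniq, hC⟩ := exists_unique_longest_noncrossing (max N 3) (le_max_right _ _)
  obtain ⟨D, hD, hcross⟩ := hN P (hP ▸ le_max_left N 3)
  exact hcross (huniq D hD ▸ hC)
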